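/- Let $I\subseteq\mathbb R$ be a non-empty open interval and let $X:I\to\mathbb R^2$ be a strictly locally convex plane curve. That is: $X$ is of class $C^3$ and regular ($X'\neq 0$ on $I$); $X$ is locally convex, i.e. every $s\in I$ lies in an open subinterval $I_0\subseteq I$ such that for each $u\in I_0$ the set $X(I_0)$ lies in one of the two closed half-planes bounded by the tangent line at $X(u)$; and the curvature $\kappa=\langle X'',N\rangle/\|X'\|^2$ of $X$ is positive on $I$, where $N$ is the unit normal pointing to the convex side (for each $s\in I$, $\langle X(u)-X(s),N(s)\rangle\ge 0$ for all $u$ near $s$). For a point $P=X(s)$ of the curve and sufficiently small $h>0$, let $\ell$ be the line through $P+hN(P)$ parallel to the tangent line at $P$; let $A$ and $B$ be the two points in which $\ell$ meets the curve near $P$, i.e. $A=X(a)$ and $B=X(b)$ where $a$ is the last parameter before $s$ and $b$ is the first parameter after $s$ at which the curve meets $\ell$; let $Q$ be the intersection point of the tangent lines of $X$ at $A$ and $B$. Let $j_P(h)$ be the distance from the centroid of the triangle $QAB$ to the line $\ell$. Then the following three conditions are equivalent. 1. There are real-valued functions $\lambda$ and $\mu$ of the point $P$ of the curve such that, for every $P$,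 $j_P(h)=\lambda(P)\,h^{\mu(P)}$ for all sufficiently small $h>0$. 2. For every point $P$ of the curve, $j_P(h)=\frac23 h$ for all sufficiently small $h>0$. 3. $X$ is an open part of a parabola, i.e. $X(I)$ is a relatively open subset of a parabola. In 1 and 2, points of the curve are points with their parameter $s\in I$, and how small $h$ has to be may depend on the point. -/

import Mathlib

open Filter Topology
open scoped RealInnerProductSpace

noncomputable section

namespace PlaneCurve

/-- The Euclidean plane. -/
abbrev Plane : Type := EuclideanSpace ℝ (Fin 2)

/-- The tangent line of the curve `X` at the parameter `s`. -/
def tangentLine (X : ℝ → Plane) (s : ℝ) : AffineSubspace ℝ Plane :=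
  AffineSubspace.mk' (X s) (Submodule.span ℝ {deriv X s})

/-- The curve `X` restricted to `I` is convex: for every `s ∈ I` the trace `X(I)` lies in one of
the two closed half-planes bounded by the tangent line at `X s`. -/
def IsConvexCurve (I : Set ℝ) (X : ℝ → Plane) : Prop :=
  ∀ s ∈ I, ∃ n : Plane, n ≠ 0 ∧ ⟪n, deriv X s⟫ = 0 ∧ ∀ u ∈ I, 0 ≤ ⟪n, X u - X s⟫

/-- Every `s ∈ I` has an open subinterval `I₀ ⊆ I` around it on which `X` is convex. -/
def IsLocallyConvexCurve (I : Set ℝ) (X : ℝ → Plane) : Prop :=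
  ∀ s ∈ I, ∃ I₀ : Set ℝ, I₀ ⊆ I ∧ IsOpen I₀ ∧ I₀.OrdConnected ∧ s ∈ I₀ ∧ IsConvexCurve I₀ X

/-- The curvature of a regular curve `X` with respect to the unit normal `N`. In an arc-length
parametrization `‖X'‖ = 1` and this is `⟨X'', N⟩`; the quotient is invariant under regular
changes of the parameter. -/
def curvature (X N : ℝ → Plane) (s : ℝ) : ℝ :=
  ⟪deriv (deriv X) s, N s⟫ / ‖deriv X s‖ ^ 2

/-- `X : I → ℝ²` is a strictly locally convex curve, and `N s` is, for `s ∈ I`, its unit normal at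
`X s` that points to the convex side. -/
structure IsStrictlyLocallyConvex (I : Set ℝ) (X N : ℝ → Plane) : Prop where
  isOpen : IsOpen I
  ordConnected : I.OrdConnected
  nonempty : I.Nonempty
  contDiffOn : ContDiffOn ℝ 3 X I
  regular : ∀ s ∈ I, deriv X s ≠ 0
  locallyConvex : IsLocallyConvexCurve I X
  norm_normal : ∀ s ∈ I, ‖N s‖ = 1
  inner_normal : ∀ s ∈ I, ⟪deriv X s, N s⟫ = 0
  convexSide : ∀ s ∈ I, ∀ᶠ u in 𝓝 s, 0 ≤ ⟪X u - X s, N s⟫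
  curvature_pos : ∀ s ∈ I, 0 < curvature X N s

/-- The line `ℓ` through `P + h N(P)` parallel to the tangent line at `P = X s`. -/
def chordLine (X N : ℝ → Plane) (s h : ℝ) : AffineSubspace ℝ Plane :=
  AffineSubspace.mk' (X s + h • N s) (Submodule.span ℝ {deriv X s})

/-- The parameter of `A`: the last parameter before `s` at which the curve meets `ℓ`. -/
def paramA (I : Set ℝ) (X N : ℝ → Plane) (s h : ℝ) : ℝ :=
  sSup {u | u ∈ I ∧ u < s ∧ X u ∈ chordLine X N s h}

/-- The parameter of `B`: the first parameter after `s` at which the curve meets `ℓ`. -/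
def paramB (I : Set ℝ) (X N : ℝ → Plane) (s h : ℝ) : ℝ :=
  sInf {u | u ∈ I ∧ s < u ∧ X u ∈ chordLine X N s h}

/-- The endpoint `A` of the chord cut out by `ℓ` near `P = X s`. -/
def pointA (I : Set ℝ) (X N : ℝ → Plane) (s h : ℝ) : Plane := X (paramA I X N s h)

/-- The endpoint `B` of the chord cut out by `ℓ` near `P = X s`. -/
def pointB (I : Set ℝ) (X N : ℝ → Plane) (s h : ℝ) : Plane := X (paramB I X N s h)

/-- The intersection point `Q` of the tangent lines at `A` and `B` (these lines meet in exactly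
one point for small `h > 0`). -/
def pointQ (I : Set ℝ) (X N : ℝ → Plane) (s h : ℝ) : Plane :=
  Classical.epsilon fun q : Plane =>
    q ∈ tangentLine X (paramA I X N s h) ∧ q ∈ tangentLine X (paramB I X N s h)

/-- The centroid `J` of the triangle `QAB`. -/
def centroidJ (I : Set ℝ) (X N : ℝ → Plane) (s h : ℝ) : Plane :=
  (1 / 3 : ℝ) • (pointQ I X N s h + pointA I X N s h + pointB I X N s h)

/-- `j_P(h)` for `P = X s`: the distance from the centroid `J` of `QAB` to the line `ℓ`. -/
def distJ (I : Set ℝ) (X N : ℝ → Plane) (s h : ℝ) : ℝ :=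
  Metric.infDist (centroidJ I X N s h) (chordLine X N s h : Set Plane)

/-- A parabola: the points equidistant from a focus `F` and a directrix
`{x | ⟨n, x⟩ = c}`, `‖n‖ = 1`, that does not contain `F`. -/
def IsParabola (C : Set Plane) : Prop :=
  ∃ (F n : Plane) (c : ℝ), ‖n‖ = 1 ∧ ⟪n, F⟫ ≠ c ∧ C = {x | dist x F = |⟪n, x⟫ - c|}

/-- The trace `X(I)` is a relatively open subset of a parabola. -/
def IsOpenPartOfParabola (I : Set ℝ) (X : ℝ → Plane) : Prop :=
  ∃ C : Set Plane, IsParabola C ∧ ∃ U : Set Plane, IsOpen U ∧ X '' I = C ∩ U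

end PlaneCurve

end

noncomputable section

namespace PlaneCurve

/-! Fix `P` and let `L(h)` be the chord `AB` at height `h` over the tangent at `P`, measured along
the velocity. The inverse slopes of the tangents at `A` and `B` differ by `L'(h)`, so `Q` lies at
distance `L / L'` from `ℓ`. Since `A` and `B` lie on `ℓ`, this gives `j = L / (3 L')` (`distJ_eq`).
Positive curvature forces `L` to grow like `√h` and `L / L'` like `2 h`; hence `j / h → 2/3`, and
the only power law possible is `2 h / 3`. Moreover `L / L' = 2 h` integrates to `L ^ 2 = C h`, so
condition 2 says that small chords parallel to a tangent are as long as on a parabola. On an actual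
parabola this is a direct computation.

The converse is the substance. Write the curve locally as a graph with `y'' = ψ ^ (-3)`; the
parabolas are the graphs for which `ψ ^ 2` is affine in `x`. The chord property at a point with `ψ =
m` reads `(Δx)² = 8 H m³`. Suppose that there `ψ ^ 2` is touched by `Q = m² + 2 q t - ε t²`, from
above with `ε > 0` or from below with `ε < 0`. The conic solving `y'' = Q ^ (-3/2)` has chords with
`(Δx)² = 8 H m³ - 4 ε m⁴ H²`, and comparing the curve with it contradicts the chord property
(`false_of_touching`). A maximum principle then makes `ψ ^ 2` affine (`sq_affine_of_chord`) without
further derivatives of the curve.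

For the coordinate `x = ⟪X, e⟫` one has `ψ = ⟪V, e⟫` with `V` the affine tangent, and half the slope
of `ψ ^ 2` is the `e`-component of the affine normal. So the affine normal is constant
(`affineNormal_eq`), and integrating twice in affine arc length gives a parabola. -/

/-! ### Linear algebra of the plane and the chord line -/

theorem inner_eq_coord (v w : Plane) : ⟪v, w⟫ = v 0 * w 0 + v 1 * w 1 := by
  simp [PiLp.inner_apply, Fin.sum_univ_two, mul_comm]

theorem norm_sq_eq_coord (v : Plane) : ‖v‖ ^ 2 = v 0 ^ 2 + v 1 ^ 2 := by
  simp [EuclideanSpace.norm_sq_eq, Fin.sum_univ_two]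

theorem plane_ext {v w : Plane} (h0 : v 0 = w 0) (h1 : v 1 = w 1) : v = w := by
  ext i; fin_cases i <;> assumption

/-- The rotation of the plane by a quarter turn. -/
def rot (v : Plane) : Plane := !₂[-v 1, v 0]

@[simp] theorem rot_zero (v : Plane) : rot v 0 = -v 1 := rfl

@[simp] theorem rot_one (v : Plane) : rot v 1 = v 0 := rfl

/-- In the plane, a vector orthogonal to `n ≠ 0` is a multiple of any nonzero vector orthogonal
to `n`. -/
theorem eq_smul_of_inner_eq_zero {n t v : Plane} (hn : n ≠ 0) (ht : t ≠ 0) (htn : ⟪t, n⟫ = 0)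
    (hv : ⟪v, n⟫ = 0) : v = (⟪v, t⟫ / ‖t‖ ^ 2) • t := by
  have hn' : n 0 ^ 2 + n 1 ^ 2 ≠ 0 := by
    rw [← norm_sq_eq_coord]; simpa using hn
  have ht' : t 0 ^ 2 + t 1 ^ 2 ≠ 0 := by
    rw [← norm_sq_eq_coord]; simpa using ht
  rw [norm_sq_eq_coord]
  rw [inner_eq_coord] at *
  -- Both vectors are orthogonal to `n`, so their determinant times `‖n‖ ^ 2` vanishes.
  have hdet : v 0 * t 1 - v 1 * t 0 = 0 := by
    have h0 : (v 0 * t 1 - v 1 * t 0) * (n 0 ^ 2 + n 1 ^ 2) = 0 := by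
      linear_combination (n 0 * t 1 - n 1 * t 0) * hv - (n 0 * v 1 - n 1 * v 0) * htn
    exact (mul_eq_zero.1 h0).resolve_right hn'
  apply plane_ext
  · simp only [PiLp.smul_apply, smul_eq_mul]
    field_simp
    linear_combination t 1 * hdet
  · simp only [PiLp.smul_apply, smul_eq_mul]
    field_simp
    linear_combination -t 0 * hdet

theorem mem_tangentLine_iff {X : ℝ → Plane} {s : ℝ} {q : Plane} :
    q ∈ tangentLine X s ↔ ∃ l : ℝ, q = X s + l • deriv X s := by
  rw [tangentLine, AffineSubspace.mem_mk', Submodule.mem_span_singleton]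
  constructor
  · rintro ⟨l, hl⟩
    exact ⟨l, by rw [hl, vsub_eq_sub]; abel⟩
  · rintro ⟨l, rfl⟩
    exact ⟨l, by rw [vsub_eq_sub]; abel⟩

section Normal

variable {X N : ℝ → Plane} {s : ℝ}

theorem mem_chordLine_iff (hN : ‖N s‖ = 1) (hd : deriv X s ≠ 0) (ho : ⟪deriv X s, N s⟫ = 0)
    {h : ℝ} {q : Plane} : q ∈ chordLine X N s h ↔ ⟪q - X s, N s⟫ = h := by
  have hNN : ⟪N s, N s⟫ = 1 := by rw [real_inner_self_eq_norm_sq, hN]; norm_num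
  have hN0 : N s ≠ 0 := by rintro h0; simp [h0] at hN
  rw [chordLine, AffineSubspace.mem_mk', Submodule.mem_span_singleton]
  have key : ⟪q - (X s + h • N s), N s⟫ = ⟪q - X s, N s⟫ - h := by
    rw [← sub_sub, inner_sub_left _ (h • N s), real_inner_smul_left, hNN, mul_one]
  constructor
  · rintro ⟨l, hl⟩
    rw [vsub_eq_sub] at hl
    rw [← hl, real_inner_smul_left, ho] at key
    linarith
  · intro hq
    refine ⟨_, (eq_smul_of_inner_eq_zero hN0 hd ho (v := q -ᵥ (X s + h • N s)) ?_).symm⟩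
    rw [vsub_eq_sub, key, hq, sub_self]

/-- The distance to the chord line is read off from the normal coordinate. -/
theorem infDist_chordLine (hN : ‖N s‖ = 1) (hd : deriv X s ≠ 0) (ho : ⟪deriv X s, N s⟫ = 0)
    (h : ℝ) (q : Plane) :
    Metric.infDist q (chordLine X N s h : Set Plane) = |⟪q - X s, N s⟫ - h| := by
  have hNN : ⟪N s, N s⟫ = 1 := by rw [real_inner_self_eq_norm_sq, hN]; norm_num
  set d := ⟪q - X s, N s⟫ - h with hdd
  have hfoot : q - d • N s ∈ (chordLine X N s h : Set Plane) := by
    rw [SetLike.mem_coe, mem_chordLine_iff hN hd ho, sub_right_comm, inner_sub_left,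
      real_inner_smul_left, hNN]
    simp [hdd]
  apply le_antisymm
  · refine (Metric.infDist_le_dist_of_mem hfoot).trans (le_of_eq ?_)
    rw [dist_eq_norm, sub_sub_cancel, norm_smul, hN, mul_one, Real.norm_eq_abs]
  · refine (Metric.le_infDist ⟨_, hfoot⟩).2 fun z hz => ?_
    rw [SetLike.mem_coe, mem_chordLine_iff hN hd ho] at hz
    have : d = ⟪q - z, N s⟫ := by
      rw [hdd, ← hz, ← inner_sub_left, sub_sub_sub_cancel_right]
    rw [this, dist_eq_norm]
    simpa [hN] using abs_real_inner_le_norm (q - z) (N s)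

end Normal

/-! ### The two inverse branches at a nondegenerate minimum -/

/-- The first parameter after a nondegenerate minimum `s` at which `η` takes the value `h`. -/
def rightBranch (I : Set ℝ) (η : ℝ → ℝ) (s h : ℝ) : ℝ := sInf {u | u ∈ I ∧ s < u ∧ η u = h}

/-- The last parameter before a nondegenerate minimum `s` at which `η` takes the value `h`. -/
def leftBranch (I : Set ℝ) (η : ℝ → ℝ) (s h : ℝ) : ℝ := sSup {u | u ∈ I ∧ u < s ∧ η u = h}

section Branch

variable {I : Set ℝ} {η η' : ℝ → ℝ} {s k : ℝ}

theorem eventually_pos_right (h0 : η' s = 0) (hk : HasDerivAt η' k s) (kpos : 0 < k) :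
    ∀ᶠ u in 𝓝[>] s, 0 < η' u := by
  have := hk.tendsto_slope.eventually (lt_mem_nhds kpos)
  have h2 : ∀ᶠ u in 𝓝[>] s, 0 < slope η' s u :=
    this.filter_mono (nhdsWithin_mono _ fun u (hu : s < u) => ne_of_gt hu)
  filter_upwards [h2, self_mem_nhdsWithin] with u hu hsu
  rw [slope_def_field, h0, sub_zero] at hu
  have : 0 < u - s := sub_pos.2 hsu
  exact (div_pos_iff_of_pos_right this).1 hu

/-- The right branch of the inverse of `η` at a nondegenerate minimum. -/
theorem rightBranch_spec (hI : IsOpen I) (hs : s ∈ I) (hη : ∀ u ∈ I, HasDerivAt η (η' u) u)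
    (hη' : ContinuousOn η' I) (hs0 : η s = 0) (hs1 : η' s = 0) (hk : HasDerivAt η' k s)
    (kpos : 0 < k) :
    (∀ᶠ h in 𝓝[>] (0 : ℝ), rightBranch I η s h ∈ I ∧ η (rightBranch I η s h) = h ∧
      0 < η' (rightBranch I η s h) ∧
      HasDerivAt (rightBranch I η s) (η' (rightBranch I η s h))⁻¹ h) ∧
    Tendsto (rightBranch I η s) (𝓝[>] 0) (𝓝[>] s) := by
  have hpos : ∀ᶠ u in 𝓝[>] s, u ∈ I ∧ 0 < η' u :=
    (eventually_nhdsWithin_of_eventually_nhds (hI.eventually_mem hs)).and (eventually_pos_right hs1 hk kpos)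
  obtain ⟨c, hsc, hc⟩ := mem_nhdsGT_iff_exists_Ioo_subset.1 hpos
  have hsc : s < c := hsc
  have hIc : ∀ u, s ≤ u → u < c → u ∈ I := fun u h1 h2 => by
    rcases h1.eq_or_lt with rfl | h1
    · exact hs
    · exact (hc ⟨h1, h2⟩).1
  -- on each `[s, d]` with `d < c` the function is strictly increasing
  have hcont : ContinuousOn η (Set.Ico s c) := fun u hu =>
    (hη u (hIc u hu.1 hu.2)).continuousAt.continuousWithinAt
  have hmono : StrictMonoOn η (Set.Ico s c) := by
    apply strictMonoOn_of_deriv_pos (convex_Ico s c) hcont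
    intro u hu
    rw [interior_Ico] at hu
    rw [(hη u (hc hu).1).deriv]
    exact (hc hu).2
  -- the branch takes the expected value
  have hval : ∀ u ∈ Set.Ioo s c, rightBranch I η s (η u) = u := by
    intro u hu
    -- The set ranges over all of `I`, but a competitor below `u` would lie in `(s, c)`, where `η`
    -- is injective.
    apply IsLeast.csInf_eq
    refine ⟨⟨(hc hu).1, hu.1, rfl⟩, ?_⟩
    rintro v ⟨_, hv1, hv2⟩
    by_contra hlt
    push Not at hlt
    have := hmono ⟨hv1.le, hlt.trans hu.2⟩ ⟨hu.1.le, hu.2⟩ hlt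
    exact this.ne hv2
  have hsurj : ∀ d ∈ Set.Ioo s c, ∀ h ∈ Set.Ioo 0 (η d), ∃ u ∈ Set.Ioo s d, η u = h := by
    intro d hd h hh
    have := intermediate_value_Ioo hd.1.le
      (hcont.mono (fun u hu => ⟨hu.1, hu.2.trans_lt hd.2⟩) : ContinuousOn η (Set.Icc s d))
    rw [hs0] at this
    obtain ⟨u, hu, rfl⟩ := this hh
    exact ⟨u, hu, rfl⟩
  have hdpos : ∀ d ∈ Set.Ioo s c, 0 < η d := fun d hd => by
    rw [← hs0]; exact hmono ⟨le_rfl, hsc⟩ ⟨hd.1.le, hd.2⟩ hd.1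
  constructor
  · obtain ⟨d, hd⟩ := exists_between hsc
    filter_upwards [Ioo_mem_nhdsGT (hdpos d hd)] with h hh
    obtain ⟨u, hu, rfl⟩ := hsurj d hd h hh
    have huc : u ∈ Set.Ioo s c := ⟨hu.1, hu.2.trans hd.2⟩
    rw [hval u huc]
    refine ⟨(hc huc).1, rfl, (hc huc).2, ?_⟩
    have hstrict : HasStrictDerivAt η (η' u) u := by
      apply hasStrictDerivAt_of_hasDerivAt_of_continuousAt
      · filter_upwards [hI.mem_nhds (hc huc).1] with v hv using hη v hv
      · exact hη'.continuousAt (hI.mem_nhds (hc huc).1)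
    have hne : η' u ≠ 0 := (hc huc).2.ne'
    have hloc := hstrict.to_localInverse hne
    -- Near `η u` the infimum agrees with the local inverse: the latter takes values in `(s, c)`,
    -- where `hval` recovers a parameter from its height.
    refine hloc.hasDerivAt.congr_of_eventuallyEq ?_
    have hright := hstrict.hasStrictFDerivAt_equiv hne |>.eventually_right_inverse
    have hin : ∀ᶠ y in 𝓝 (η u), hstrict.localInverse η (η' u) u hne y ∈ Set.Ioo s c := by
      have h1 := hloc.hasDerivAt.continuousAt
      have h2 : hstrict.localInverse η (η' u) u hne (η u) = u :=
        (hstrict.hasStrictFDerivAt_equiv hne).localInverse_apply_image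
      apply h1.eventually
      rw [h2]
      exact Ioo_mem_nhds huc.1 huc.2
    filter_upwards [hright, hin] with y hy1 hy2
    have := hval _ hy2
    have hy1 : η (hstrict.localInverse η (η' u) u hne y) = y := hy1
    rw [hy1] at this
    exact this
  · rw [tendsto_iff_eventually]
    intro p hp
    obtain ⟨e, hse, he⟩ := mem_nhdsGT_iff_exists_Ioo_subset.1 hp
    obtain ⟨d, hd⟩ := exists_between (lt_min hsc hse)
    have hdc : d ∈ Set.Ioo s c := ⟨hd.1, hd.2.trans_le (min_le_left _ _)⟩
    filter_upwards [Ioo_mem_nhdsGT (hdpos d hdc)] with h hh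
    obtain ⟨u, hu, rfl⟩ := hsurj d hdc h hh
    rw [hval u ⟨hu.1, hu.2.trans hdc.2⟩]
    exact he ⟨hu.1, hu.2.trans (hd.2.trans_le (min_le_right _ _))⟩

/-- The reflection `u ↦ -u` exchanges the two sides of `s`, so the left branch inherits its
properties from the right one. -/
theorem leftBranch_eq_neg_rightBranch (h : ℝ) :
    leftBranch I η s h = -rightBranch (-I) (fun u => η (-u)) (-s) h := by
  rw [leftBranch, rightBranch, ← Real.sSup_neg]
  congr 1
  ext u
  simp only [Set.mem_ofPred_eq, Set.mem_neg, neg_neg, neg_lt_neg_iff]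

/-- The left branch of the inverse of `η` at a nondegenerate minimum. -/
theorem leftBranch_spec (hI : IsOpen I) (hs : s ∈ I) (hη : ∀ u ∈ I, HasDerivAt η (η' u) u)
    (hη' : ContinuousOn η' I) (hs0 : η s = 0) (hs1 : η' s = 0) (hk : HasDerivAt η' k s)
    (kpos : 0 < k) :
    (∀ᶠ h in 𝓝[>] (0 : ℝ), leftBranch I η s h ∈ I ∧ η (leftBranch I η s h) = h ∧
      η' (leftBranch I η s h) < 0 ∧
      HasDerivAt (leftBranch I η s) (η' (leftBranch I η s h))⁻¹ h) ∧
    Tendsto (leftBranch I η s) (𝓝[>] 0) (𝓝[<] s) := by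
  have hfun : leftBranch I η s = fun h => -rightBranch (-I) (fun u => η (-u)) (-s) h :=
    funext leftBranch_eq_neg_rightBranch
  have key := rightBranch_spec (I := -I) (η := fun u => η (-u)) (η' := fun u => -η' (-u))
    (s := -s) (k := k) hI.neg (by simpa using hs)
    (fun u hu => by
      exact ((hη (-u) hu).comp u (hasDerivAt_neg u)).congr_deriv (by ring))
    ((hη'.comp continuous_neg.continuousOn fun u hu => hu).neg)
    (by simpa using hs0) (by simpa using hs1)
    (by
      have : HasDerivAt η' k (-(-s)) := by rwa [neg_neg]
      exact (this.comp (-s) (hasDerivAt_neg (-s))).neg.congr_deriv (by ring)) kpos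
  rw [hfun]
  constructor
  · filter_upwards [key.1] with h ⟨h1, h2, h3, h4⟩
    refine ⟨h1, h2, by linarith, ?_⟩
    have := h4.neg
    rwa [inv_neg, neg_neg] at this
  · have := (tendsto_neg_nhdsGT (a := -s)).comp key.2
    rwa [neg_neg] at this

end Branch

/-! ### Chord length and its asymptotics -/

/-- The extent in the `x`-coordinate of the chord that the level `h` of `η` cuts out around `s`. -/
def chordLength (I : Set ℝ) (x η : ℝ → ℝ) (s h : ℝ) : ℝ :=
  x (rightBranch I η s h) - x (leftBranch I η s h)

/-- The derivative of `chordLength` with respect to the level `h`. -/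
def chordLengthDeriv (I : Set ℝ) (x' η η' : ℝ → ℝ) (s h : ℝ) : ℝ :=
  x' (rightBranch I η s h) / η' (rightBranch I η s h) -
    x' (leftBranch I η s h) / η' (leftBranch I η s h)

section Asymptotics

variable {η η' : ℝ → ℝ} {s k : ℝ}

theorem tendsto_div_sub {x : ℝ → ℝ} {c : ℝ} (h0 : x s = 0) (h : HasDerivAt x c s) :
    Tendsto (fun u => x u / (u - s)) (𝓝[≠] s) (𝓝 c) := by
  refine h.tendsto_slope.congr fun u => ?_
  rw [slope_def_field, h0, sub_zero]

/-- One application of l'Hôpital reduces this second-order expansion to the derivative of `η'` at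
the single point `s`. -/
theorem tendsto_div_sub_sq (hη : ∀ᶠ u in 𝓝 s, HasDerivAt η (η' u) u) (hs0 : η s = 0)
    (hs1 : η' s = 0) (hk : HasDerivAt η' k s) :
    Tendsto (fun u => η u / (u - s) ^ 2) (𝓝[≠] s) (𝓝 (k / 2)) := by
  apply HasDerivAt.lhopital_zero_nhdsNE (f' := η') (g' := fun u => 2 * (u - s))
  · exact eventually_nhdsWithin_of_eventually_nhds hη
  · refine Eventually.of_forall fun u => ?_
    exact (((hasDerivAt_id u).sub_const s).pow 2).congr_deriv (by simp)
  · filter_upwards [self_mem_nhdsWithin] with u hu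
    exact mul_ne_zero two_ne_zero (sub_ne_zero.2 hu)
  · have := hη.self_of_nhds.continuousAt.tendsto
    rw [hs0] at this
    exact this.mono_left nhdsWithin_le_nhds
  · have : Tendsto (fun u : ℝ => (u - s) ^ 2) (𝓝 s) (𝓝 ((s - s) ^ 2)) :=
      Continuous.tendsto (by fun_prop) s
    rw [sub_self, zero_pow two_ne_zero] at this
    exact this.mono_left nhdsWithin_le_nhds
  · refine ((tendsto_div_sub hs1 hk).div_const 2).congr fun u => ?_
    rw [div_div, mul_comm]

theorem tendsto_sqrt_div_right (hη : ∀ᶠ u in 𝓝 s, HasDerivAt η (η' u) u) (hs0 : η s = 0)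
    (hs1 : η' s = 0) (hk : HasDerivAt η' k s) :
    Tendsto (fun u => √(η u) / (u - s)) (𝓝[>] s) (𝓝 √(k / 2)) := by
  have h := ((tendsto_div_sub_sq hη hs0 hs1 hk).sqrt).mono_left
    (nhdsWithin_mono s fun u (hu : s < u) => ne_of_gt hu)
  refine h.congr' ?_
  filter_upwards [self_mem_nhdsWithin] with u hu
  rw [Real.sqrt_div' _ (sq_nonneg _), Real.sqrt_sq (sub_pos.2 hu).le]

theorem tendsto_sqrt_div_left (hη : ∀ᶠ u in 𝓝 s, HasDerivAt η (η' u) u) (hs0 : η s = 0)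
    (hs1 : η' s = 0) (hk : HasDerivAt η' k s) :
    Tendsto (fun u => √(η u) / (u - s)) (𝓝[<] s) (𝓝 (-√(k / 2))) := by
  have h := ((tendsto_div_sub_sq hη hs0 hs1 hk).sqrt).mono_left
    (nhdsWithin_mono s fun u (hu : u < s) => ne_of_lt hu)
  refine h.neg.congr' ?_
  filter_upwards [self_mem_nhdsWithin] with u hu
  have hu : u < s := hu
  rw [Real.sqrt_div' _ (sq_nonneg _), Real.sqrt_sq_eq_abs, abs_of_neg (sub_neg.2 hu), div_neg,
    neg_neg]

end Asymptotics

section Chord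

variable {I : Set ℝ} {x x' η η' : ℝ → ℝ} {s k c : ℝ}

/-- The chord length is differentiable in the level. -/
theorem hasDerivAt_chordLength (hI : IsOpen I) (hs : s ∈ I)
    (hη : ∀ u ∈ I, HasDerivAt η (η' u) u) (hη' : ContinuousOn η' I) (hs0 : η s = 0)
    (hs1 : η' s = 0) (hk : HasDerivAt η' k s) (kpos : 0 < k)
    (hx : ∀ u ∈ I, HasDerivAt x (x' u) u) :
    ∀ᶠ h in 𝓝[>] (0 : ℝ),
      HasDerivAt (chordLength I x η s) (chordLengthDeriv I x' η η' s h) h := by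
  filter_upwards [(rightBranch_spec hI hs hη hη' hs0 hs1 hk kpos).1,
    (leftBranch_spec hI hs hη hη' hs0 hs1 hk kpos).1] with h ⟨hb, _, _, hb'⟩ ⟨ha, _, _, ha'⟩
  exact (((hx _ hb).comp h hb').sub ((hx _ ha).comp h ha')).congr_deriv rfl

/-- On both branches `√h = √(η u)`, and `x` and `√η` are of first order in `u - s`. The sign of `√η
/ (u - s)` changes from right to left, so the two half chords add up. -/
theorem tendsto_chordLength_div_sqrt (hI : IsOpen I) (hs : s ∈ I)
    (hη : ∀ u ∈ I, HasDerivAt η (η' u) u) (hη' : ContinuousOn η' I) (hs0 : η s = 0)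
    (hs1 : η' s = 0) (hk : HasDerivAt η' k s) (kpos : 0 < k)
    (hx : HasDerivAt x c s) (hx0 : x s = 0) :
    Tendsto (fun h => chordLength I x η s h / √h) (𝓝[>] 0) (𝓝 (2 * c / √(k / 2))) := by
  have hη'' : ∀ᶠ u in 𝓝 s, HasDerivAt η (η' u) u := (hI.eventually_mem hs).mono hη
  obtain ⟨b1, b2⟩ := rightBranch_spec hI hs hη hη' hs0 hs1 hk kpos
  obtain ⟨a1, a2⟩ := leftBranch_spec hI hs hη hη' hs0 hs1 hk kpos
  have hkpos : √(k / 2) ≠ 0 := (Real.sqrt_pos.2 (half_pos kpos)).ne'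
  have hr := (((tendsto_div_sub hx0 hx).mono_left
    (nhdsWithin_mono s fun u (hu : s < u) => ne_of_gt hu)).div
    (tendsto_sqrt_div_right hη'' hs0 hs1 hk) hkpos).comp b2
  have hl := (((tendsto_div_sub hx0 hx).mono_left
    (nhdsWithin_mono s fun u (hu : u < s) => ne_of_lt hu)).div
    (tendsto_sqrt_div_left hη'' hs0 hs1 hk) (neg_ne_zero.2 hkpos)).comp a2
  have := hr.sub hl
  rw [show c / √(k / 2) - c / -√(k / 2) = 2 * c / √(k / 2) by rw [div_neg]; ring] at this
  refine this.congr' ?_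
  filter_upwards [b1, a1, b2 self_mem_nhdsWithin, a2 self_mem_nhdsWithin] with h hb ha hbs has
  have hbs : s < rightBranch I η s h := hbs
  have has : leftBranch I η s h < s := has
  simp only [Function.comp_apply, Pi.div_apply]
  rw [hb.2.1, ha.2.1, div_div_div_cancel_right₀ (sub_pos.2 hbs).ne',
    div_div_div_cancel_right₀ (sub_neg.2 has).ne, ← sub_div, chordLength]

/-- Each term `x' / η'` blows up like `x' s / (k (u - s))`, which the factor `√h ≈ √(k / 2) |u - s|`
compensates. -/
theorem tendsto_sqrt_mul_chordLengthDeriv (hI : IsOpen I) (hs : s ∈ I)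
    (hη : ∀ u ∈ I, HasDerivAt η (η' u) u) (hη' : ContinuousOn η' I) (hs0 : η s = 0)
    (hs1 : η' s = 0) (hk : HasDerivAt η' k s) (kpos : 0 < k)
    (hx : ContinuousAt x' s) :
    Tendsto (fun h => √h * chordLengthDeriv I x' η η' s h) (𝓝[>] 0)
      (𝓝 (2 * x' s * √(k / 2) / k)) := by
  have hη'' : ∀ᶠ u in 𝓝 s, HasDerivAt η (η' u) u := (hI.eventually_mem hs).mono hη
  obtain ⟨b1, b2⟩ := rightBranch_spec hI hs hη hη' hs0 hs1 hk kpos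
  obtain ⟨a1, a2⟩ := leftBranch_spec hI hs hη hη' hs0 hs1 hk kpos
  have hr := ((((tendsto_sqrt_div_right hη'' hs0 hs1 hk).mul
    (hx.tendsto.mono_left nhdsWithin_le_nhds)).div ((tendsto_div_sub hs1 hk).mono_left
    (nhdsWithin_mono s fun u (hu : s < u) => ne_of_gt hu)) kpos.ne')).comp b2
  have hl := ((((tendsto_sqrt_div_left hη'' hs0 hs1 hk).mul
    (hx.tendsto.mono_left nhdsWithin_le_nhds)).div ((tendsto_div_sub hs1 hk).mono_left
    (nhdsWithin_mono s fun u (hu : u < s) => ne_of_lt hu)) kpos.ne')).comp a2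
  have := hr.sub hl
  rw [show √(k / 2) * x' s / k - -√(k / 2) * x' s / k = 2 * x' s * √(k / 2) / k by ring] at this
  refine this.congr' ?_
  filter_upwards [b1, a1, b2 self_mem_nhdsWithin, a2 self_mem_nhdsWithin] with h hb ha hbs has
  have hbs : s < rightBranch I η s h := hbs
  have has : leftBranch I η s h < s := has
  have hb0 := (sub_pos.2 hbs).ne'
  have ha0 := (sub_neg.2 has).ne
  have hb1 := hb.2.2.1.ne'
  have ha1 := ha.2.2.1.ne
  simp only [Function.comp_apply, Pi.div_apply, chordLengthDeriv]
  rw [hb.2.1, ha.2.1]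
  field_simp

theorem tendsto_chordLength_sq_div (hI : IsOpen I) (hs : s ∈ I)
    (hη : ∀ u ∈ I, HasDerivAt η (η' u) u) (hη' : ContinuousOn η' I) (hs0 : η s = 0)
    (hs1 : η' s = 0) (hk : HasDerivAt η' k s) (kpos : 0 < k)
    (hx : HasDerivAt x c s) (hx0 : x s = 0) :
    Tendsto (fun h => chordLength I x η s h ^ 2 / h) (𝓝[>] 0) (𝓝 (8 * c ^ 2 / k)) := by
  have := (tendsto_chordLength_div_sqrt hI hs hη hη' hs0 hs1 hk kpos hx hx0).pow 2
  rw [div_pow, Real.sq_sqrt (half_pos kpos).le,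
    show (2 * c) ^ 2 / (k / 2) = 8 * c ^ 2 / k by field_simp; ring] at this
  refine this.congr' ?_
  filter_upwards [self_mem_nhdsWithin] with h hh
  rw [div_pow, Real.sq_sqrt (le_of_lt hh)]

/-- In the quotient of the two preceding limits both `k` and `x' s` cancel. This is where the
universal constant of the theorem comes from. -/
theorem tendsto_chordLength_div_deriv (hI : IsOpen I) (hs : s ∈ I)
    (hη : ∀ u ∈ I, HasDerivAt η (η' u) u) (hη' : ContinuousOn η' I) (hs0 : η s = 0)
    (hs1 : η' s = 0) (hk : HasDerivAt η' k s) (kpos : 0 < k)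
    (hx : HasDerivAt x (x' s) s) (hx0 : x s = 0) (hx' : ContinuousAt x' s) (cpos : 0 < x' s) :
    Tendsto (fun h => chordLength I x η s h / chordLengthDeriv I x' η η' s h / h) (𝓝[>] 0)
      (𝓝 2) := by
  have hr : 0 < √(k / 2) := Real.sqrt_pos.2 (half_pos kpos)
  have := (tendsto_chordLength_div_sqrt hI hs hη hη' hs0 hs1 hk kpos hx hx0).div
    (tendsto_sqrt_mul_chordLengthDeriv hI hs hη hη' hs0 hs1 hk kpos hx') (by positivity)
  rw [show 2 * x' s / √(k / 2) / (2 * x' s * √(k / 2) / k) = 2 by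
    have h2 := Real.sq_sqrt (half_pos kpos).le
    field_simp
    linarith] at this
  refine this.congr' ?_
  filter_upwards [self_mem_nhdsWithin] with h hh
  simp only [Pi.div_apply]
  rw [div_div, ← mul_assoc, Real.mul_self_sqrt (le_of_lt hh), div_div, mul_comm h]

theorem eventually_chordLengthDeriv_pos (hI : IsOpen I) (hs : s ∈ I)
    (hη : ∀ u ∈ I, HasDerivAt η (η' u) u) (hη' : ContinuousOn η' I) (hs0 : η s = 0)
    (hs1 : η' s = 0) (hk : HasDerivAt η' k s) (kpos : 0 < k)
    (hx' : ContinuousAt x' s) (cpos : 0 < x' s) :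
    ∀ᶠ h in 𝓝[>] (0 : ℝ), 0 < chordLengthDeriv I x' η η' s h := by
  have hr : 0 < √(k / 2) := Real.sqrt_pos.2 (half_pos kpos)
  have := (tendsto_sqrt_mul_chordLengthDeriv hI hs hη hη' hs0 hs1 hk kpos hx').eventually
    (lt_mem_nhds (show 0 < 2 * x' s * √(k / 2) / k by positivity))
  filter_upwards [this, self_mem_nhdsWithin] with h h1 hh
  exact (pos_iff_pos_of_mul_pos h1).1 (Real.sqrt_pos.2 hh)

theorem eventually_chordLength_pos (hI : IsOpen I) (hs : s ∈ I)
    (hη : ∀ u ∈ I, HasDerivAt η (η' u) u) (hη' : ContinuousOn η' I) (hs0 : η s = 0)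
    (hs1 : η' s = 0) (hk : HasDerivAt η' k s) (kpos : 0 < k)
    (hx : HasDerivAt x c s) (hx0 : x s = 0) (cpos : 0 < c) :
    ∀ᶠ h in 𝓝[>] (0 : ℝ), 0 < chordLength I x η s h := by
  have hr : 0 < √(k / 2) := Real.sqrt_pos.2 (half_pos kpos)
  have := (tendsto_chordLength_div_sqrt hI hs hη hη' hs0 hs1 hk kpos hx hx0).eventually
    (lt_mem_nhds (show 0 < 2 * c / √(k / 2) by positivity))
  filter_upwards [this, self_mem_nhdsWithin] with h h1 hh
  exact (div_pos_iff_of_pos_right (Real.sqrt_pos.2 hh)).1 h1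

end Chord

/-! ### The equation `L / L' = 2 h` and power laws -/

/-- A function `L` with `L / L' = 2 h` near `0` has square proportional to `h`. -/
theorem eventually_sq_eq_mul_of_div_deriv {L L' : ℝ → ℝ} {C : ℝ}
    (hL : ∀ᶠ h in 𝓝[>] (0 : ℝ), HasDerivAt L (L' h) h) (hpos : ∀ᶠ h in 𝓝[>] (0 : ℝ), 0 < L' h)
    (hC : Tendsto (fun h => L h ^ 2 / h) (𝓝[>] 0) (𝓝 C))
    (heq : ∀ᶠ h in 𝓝[>] (0 : ℝ), L h / L' h = 2 * h) :
    ∀ᶠ h in 𝓝[>] (0 : ℝ), L h ^ 2 = C * h := by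
  obtain ⟨d, hd0, hd⟩ := mem_nhdsGT_iff_exists_Ioo_subset.1 (hL.and (hpos.and heq))
  have hd0 : (0 : ℝ) < d := hd0
  -- The numerator of the derivative is `2 L L' h - L ^ 2 = L (2 h L' - L) = 0`.
  have hder : ∀ h ∈ Set.Ioo 0 d, HasDerivAt (fun h => L h ^ 2 / h) 0 h := by
    intro h hh
    obtain ⟨h1, h2, h3⟩ := hd hh
    refine ((h1.pow 2).div (hasDerivAt_id h) hh.1.ne').congr_deriv ?_
    have h3 : L h / L' h = 2 * h := h3
    rw [div_eq_iff (ne_of_gt h2)] at h3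
    simp only [Pi.pow_apply, id, h3]
    rw [div_eq_zero_iff]
    left
    push_cast
    ring
  have hconst : ∀ h ∈ Set.Ioo 0 d, ∀ h' ∈ Set.Ioo 0 d, L h ^ 2 / h = L h' ^ 2 / h' := by
    intro h hh h' hh'
    exact isOpen_Ioo.is_const_of_deriv_eq_zero isPreconnected_Ioo
      (fun z hz => (hder z hz).differentiableAt.differentiableWithinAt)
      (fun z hz => (hder z hz).deriv) hh hh'
  filter_upwards [Ioo_mem_nhdsGT hd0] with h hh
  have : Tendsto (fun h => L h ^ 2 / h) (𝓝[>] 0) (𝓝 (L h ^ 2 / h)) := by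
    refine tendsto_const_nhds.congr' ?_
    filter_upwards [Ioo_mem_nhdsGT hd0] with h' hh'
    exact hconst h hh h' hh'
  rw [← tendsto_nhds_unique this hC, div_mul_cancel₀ _ hh.1.ne']

/-- Differentiating `L ^ 2 = C h` gives `2 L L' = C = L ^ 2 / h`, and `L > 0` can be cancelled. -/
theorem eventually_div_deriv_of_sq_eq_mul {L L' : ℝ → ℝ} {C : ℝ}
    (hL : ∀ᶠ h in 𝓝[>] (0 : ℝ), HasDerivAt L (L' h) h) (hpos : ∀ᶠ h in 𝓝[>] (0 : ℝ), 0 < L' h)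
    (heq : ∀ᶠ h in 𝓝[>] (0 : ℝ), L h ^ 2 = C * h) (hLpos : ∀ᶠ h in 𝓝[>] (0 : ℝ), 0 < L h) :
    ∀ᶠ h in 𝓝[>] (0 : ℝ), L h / L' h = 2 * h := by
  obtain ⟨d, hd0, hd⟩ := mem_nhdsGT_iff_exists_Ioo_subset.1 (hL.and (hpos.and (heq.and hLpos)))
  have hd0 : (0 : ℝ) < d := hd0
  filter_upwards [Ioo_mem_nhdsGT hd0] with h hh
  obtain ⟨h1, h2, h3, h4⟩ := hd hh
  have hsq : HasDerivAt (fun h => L h ^ 2) C h := by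
    refine HasDerivAt.congr_of_eventuallyEq (f := fun h => C * h) ?_ ?_
    · simpa using (hasDerivAt_id h).const_mul C
    · filter_upwards [isOpen_Ioo.mem_nhds hh] with h' hh' using (hd hh').2.2.1
  have := hsq.unique (h1.pow 2)
  have h3 : L h ^ 2 = C * h := h3
  rw [this] at h3
  rw [div_eq_iff (ne_of_gt h2)]
  apply mul_left_cancel₀ (ne_of_gt h4)
  norm_num at h3
  linarith

/-- If `l h ^ m / h` tends to `r > 0` as `h` decreases to `0`, then `m = 1` and `l = r`. -/
theorem eq_of_tendsto_mul_rpow_div {l m r : ℝ} (hr : 0 < r)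
    (h : Tendsto (fun h : ℝ => l * h ^ m / h) (𝓝[>] 0) (𝓝 r)) : l = r ∧ m = 1 := by
  have hm : m = 1 := by
    have hlim : Tendsto (fun h : ℝ => l * h ^ (m - 1)) (𝓝[>] 0) (𝓝 r) := by
      refine h.congr' ?_
      filter_upwards [self_mem_nhdsWithin] with h hh
      rw [Real.rpow_sub_one (ne_of_gt hh), mul_div_assoc]
    rcases lt_trichotomy m 1 with hlt | heq | hgt
    · exfalso
      have h0 : Tendsto (fun h : ℝ => h ^ (1 - m)) (𝓝[>] 0) (𝓝 0) := by
        have := (Real.continuousAt_rpow_const 0 (1 - m) (Or.inr (sub_pos.2 hlt).le)).tendsto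
        rw [Real.zero_rpow (sub_pos.2 hlt).ne'] at this
        exact this.mono_left nhdsWithin_le_nhds
      have h1 := hlim.mul h0
      rw [mul_zero] at h1
      have h2 : Tendsto (fun _ : ℝ => l) (𝓝[>] (0 : ℝ)) (𝓝 0) := by
        refine h1.congr' ?_
        filter_upwards [self_mem_nhdsWithin] with h hh
        rw [mul_assoc, ← Real.rpow_add hh]
        simp
      have hl : l = 0 := tendsto_nhds_unique tendsto_const_nhds h2
      simp only [hl, zero_mul] at hlim
      exact hr.ne (tendsto_nhds_unique tendsto_const_nhds hlim)
    · exact heq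
    · exfalso
      have h0 : Tendsto (fun h : ℝ => l * h ^ (m - 1)) (𝓝[>] 0) (𝓝 (l * 0)) := by
        have := (Real.continuousAt_rpow_const 0 (m - 1) (Or.inr (sub_pos.2 hgt).le)).tendsto
        rw [Real.zero_rpow (sub_pos.2 hgt).ne'] at this
        exact (this.mono_left nhdsWithin_le_nhds).const_mul l
      rw [mul_zero] at h0
      exact hr.ne' (tendsto_nhds_unique hlim h0)
  refine ⟨?_, hm⟩
  subst hm
  refine tendsto_nhds_unique (tendsto_const_nhds.congr' ?_) h
  filter_upwards [self_mem_nhdsWithin] with h hh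
  rw [Real.rpow_one, mul_div_cancel_right₀ _ (ne_of_gt hh)]

/-! ### The centroid distance as a function of the chord -/

/-- The coordinate of `X u` in the direction of the normal at `X s`. -/
def normalCoord (X N : ℝ → Plane) (s u : ℝ) : ℝ := ⟪X u - X s, N s⟫

/-- The coordinate of `X u` in the direction of the velocity at `X s`. -/
def tangentCoord (X : ℝ → Plane) (s u : ℝ) : ℝ := ⟪X u - X s, deriv X s⟫

theorem eq_zero_of_inner_eq_zero {n t v : Plane} (hn : n ≠ 0) (ht : t ≠ 0) (htn : ⟪t, n⟫ = 0)
    (hvn : ⟪v, n⟫ = 0) (hvt : ⟪v, t⟫ = 0) : v = 0 := by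
  rw [eq_smul_of_inner_eq_zero hn ht htn hvn, hvt, zero_div, zero_smul]

namespace IsStrictlyLocallyConvex

variable {I : Set ℝ} {X N : ℝ → Plane} {s : ℝ}

theorem contDiffOn_deriv (hX : IsStrictlyLocallyConvex I X N) : ContDiffOn ℝ 2 (deriv X) I :=
  hX.contDiffOn.deriv_of_isOpen hX.isOpen (by norm_num)

theorem contDiffOn_deriv_deriv (hX : IsStrictlyLocallyConvex I X N) :
    ContDiffOn ℝ 1 (deriv (deriv X)) I :=
  hX.contDiffOn_deriv.deriv_of_isOpen hX.isOpen (by norm_num)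

theorem hasDerivAt (hX : IsStrictlyLocallyConvex I X N) (hs : s ∈ I) :
    HasDerivAt X (deriv X s) s :=
  ((hX.contDiffOn.differentiableOn (by norm_num)).differentiableAt
    (hX.isOpen.mem_nhds hs)).hasDerivAt

theorem hasDerivAt_deriv (hX : IsStrictlyLocallyConvex I X N) (hs : s ∈ I) :
    HasDerivAt (deriv X) (deriv (deriv X) s) s :=
  ((hX.contDiffOn_deriv.differentiableOn (by norm_num)).differentiableAt
    (hX.isOpen.mem_nhds hs)).hasDerivAt

theorem differentiableAt_deriv_deriv (hX : IsStrictlyLocallyConvex I X N) (hs : s ∈ I) :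
    DifferentiableAt ℝ (deriv (deriv X)) s :=
  (hX.contDiffOn_deriv_deriv.differentiableOn (by norm_num)).differentiableAt
    (hX.isOpen.mem_nhds hs)

theorem normal_ne_zero (hX : IsStrictlyLocallyConvex I X N) (hs : s ∈ I) : N s ≠ 0 := by
  intro h
  have := hX.norm_normal s hs
  simp [h] at this

theorem inner_deriv_deriv_normal_pos (hX : IsStrictlyLocallyConvex I X N) (hs : s ∈ I) :
    0 < ⟪deriv (deriv X) s, N s⟫ :=
  (div_pos_iff_of_pos_right (pow_pos (norm_pos_iff.2 (hX.regular s hs)) 2)).1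
    (hX.curvature_pos s hs)

theorem hasDerivAt_normalCoord (hX : IsStrictlyLocallyConvex I X N) {u : ℝ} (hu : u ∈ I) :
    HasDerivAt (normalCoord X N s) ⟪deriv X u, N s⟫ u := by
  have := ((hX.hasDerivAt hu).sub_const (X s)).inner ℝ (hasDerivAt_const u (N s))
  simp only [inner_zero_right, zero_add] at this
  exact this

theorem hasDerivAt_inner_deriv (hX : IsStrictlyLocallyConvex I X N) {u : ℝ} (hu : u ∈ I)
    (v : Plane) : HasDerivAt (fun u => ⟪deriv X u, v⟫) ⟪deriv (deriv X) u, v⟫ u := by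
  simpa using (hX.hasDerivAt_deriv hu).inner ℝ (hasDerivAt_const u v)

theorem continuousOn_inner_deriv (hX : IsStrictlyLocallyConvex I X N) (v : Plane) :
    ContinuousOn (fun u => ⟪deriv X u, v⟫) I :=
  fun _ hu => (hX.hasDerivAt_inner_deriv hu v).continuousAt.continuousWithinAt

theorem hasDerivAt_tangentCoord (hX : IsStrictlyLocallyConvex I X N) {u : ℝ} (hu : u ∈ I) :
    HasDerivAt (tangentCoord X s) ⟪deriv X u, deriv X s⟫ u := by
  have := ((hX.hasDerivAt hu).sub_const (X s)).inner ℝ (hasDerivAt_const u (deriv X s))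
  simp only [inner_zero_right, zero_add] at this
  exact this

theorem normalCoord_self : normalCoord X N s s = 0 := by simp [normalCoord]

theorem tangentCoord_self : tangentCoord X s s = 0 := by simp [tangentCoord]

theorem inner_deriv_self_pos (hX : IsStrictlyLocallyConvex I X N) (hs : s ∈ I) :
    0 < ⟪deriv X s, deriv X s⟫ :=
  real_inner_self_pos.2 (hX.regular s hs)

theorem paramA_eq (hX : IsStrictlyLocallyConvex I X N) (hs : s ∈ I) :
    paramA I X N s = leftBranch I (normalCoord X N s) s := by
  funext h
  simp only [paramA, leftBranch, normalCoord,
    mem_chordLine_iff (hX.norm_normal s hs) (hX.regular s hs) (hX.inner_normal s hs)]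

theorem paramB_eq (hX : IsStrictlyLocallyConvex I X N) (hs : s ∈ I) :
    paramB I X N s = rightBranch I (normalCoord X N s) s := by
  funext h
  simp only [paramB, rightBranch, normalCoord,
    mem_chordLine_iff (hX.norm_normal s hs) (hX.regular s hs) (hX.inner_normal s hs)]

theorem paramB_spec (hX : IsStrictlyLocallyConvex I X N) (hs : s ∈ I) :
    (∀ᶠ h in 𝓝[>] (0 : ℝ), paramB I X N s h ∈ I ∧ normalCoord X N s (paramB I X N s h) = h ∧
      0 < ⟪deriv X (paramB I X N s h), N s⟫) ∧
    Tendsto (paramB I X N s) (𝓝[>] 0) (𝓝[>] s) := by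
  have := rightBranch_spec hX.isOpen hs (fun _ hu => hX.hasDerivAt_normalCoord (s := s) hu)
    (hX.continuousOn_inner_deriv (N s)) normalCoord_self (hX.inner_normal s hs)
    (hX.hasDerivAt_inner_deriv hs (N s)) (hX.inner_deriv_deriv_normal_pos hs)
  rw [hX.paramB_eq hs]
  exact ⟨this.1.mono fun h hh => ⟨hh.1, hh.2.1, hh.2.2.1⟩, this.2⟩

theorem paramA_spec (hX : IsStrictlyLocallyConvex I X N) (hs : s ∈ I) :
    (∀ᶠ h in 𝓝[>] (0 : ℝ), paramA I X N s h ∈ I ∧ normalCoord X N s (paramA I X N s h) = h ∧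
      ⟪deriv X (paramA I X N s h), N s⟫ < 0) ∧
    Tendsto (paramA I X N s) (𝓝[>] 0) (𝓝[<] s) := by
  have := leftBranch_spec hX.isOpen hs (fun _ hu => hX.hasDerivAt_normalCoord (s := s) hu)
    (hX.continuousOn_inner_deriv (N s)) normalCoord_self (hX.inner_normal s hs)
    (hX.hasDerivAt_inner_deriv hs (N s)) (hX.inner_deriv_deriv_normal_pos hs)
  rw [hX.paramA_eq hs]
  exact ⟨this.1.mono fun h hh => ⟨hh.1, hh.2.1, hh.2.2.1⟩, this.2⟩

/-- The chord `AB`, measured along the velocity at `X s`. -/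
def chord (I : Set ℝ) (X N : ℝ → Plane) (s : ℝ) : ℝ → ℝ :=
  chordLength I (tangentCoord X s) (normalCoord X N s) s

/-- The derivative of `chord` in the height `h`. -/
def chordDeriv (I : Set ℝ) (X N : ℝ → Plane) (s : ℝ) : ℝ → ℝ :=
  chordLengthDeriv I (fun u => ⟪deriv X u, deriv X s⟫) (normalCoord X N s)
    (fun u => ⟪deriv X u, N s⟫) s

theorem chord_eq (hX : IsStrictlyLocallyConvex I X N) (hs : s ∈ I) (h : ℝ) :
    chord I X N s h =
      tangentCoord X s (paramB I X N s h) - tangentCoord X s (paramA I X N s h) := by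
  rw [chord, chordLength, hX.paramA_eq hs, hX.paramB_eq hs]

theorem chord_pos (hX : IsStrictlyLocallyConvex I X N) (hs : s ∈ I) :
    ∀ᶠ h in 𝓝[>] (0 : ℝ), 0 < chord I X N s h :=
  eventually_chordLength_pos hX.isOpen hs (fun _ hu => hX.hasDerivAt_normalCoord (s := s) hu)
    (hX.continuousOn_inner_deriv (N s)) normalCoord_self (hX.inner_normal s hs)
    (hX.hasDerivAt_inner_deriv hs (N s)) (hX.inner_deriv_deriv_normal_pos hs)
    (hX.hasDerivAt_tangentCoord hs) tangentCoord_self (hX.inner_deriv_self_pos hs)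

theorem chordDeriv_pos (hX : IsStrictlyLocallyConvex I X N) (hs : s ∈ I) :
    ∀ᶠ h in 𝓝[>] (0 : ℝ), 0 < chordDeriv I X N s h :=
  eventually_chordLengthDeriv_pos (x' := fun u => ⟪deriv X u, deriv X s⟫) hX.isOpen hs
    (fun _ hu => hX.hasDerivAt_normalCoord (s := s) hu)
    (hX.continuousOn_inner_deriv (N s)) normalCoord_self (hX.inner_normal s hs)
    (hX.hasDerivAt_inner_deriv hs (N s)) (hX.inner_deriv_deriv_normal_pos hs)
    (hX.hasDerivAt_inner_deriv hs _).continuousAt (hX.inner_deriv_self_pos hs)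

theorem hasDerivAt_chord (hX : IsStrictlyLocallyConvex I X N) (hs : s ∈ I) :
    ∀ᶠ h in 𝓝[>] (0 : ℝ), HasDerivAt (chord I X N s) (chordDeriv I X N s h) h :=
  hasDerivAt_chordLength hX.isOpen hs (fun _ hu => hX.hasDerivAt_normalCoord (s := s) hu)
    (hX.continuousOn_inner_deriv (N s)) normalCoord_self (hX.inner_normal s hs)
    (hX.hasDerivAt_inner_deriv hs (N s)) (hX.inner_deriv_deriv_normal_pos hs)
    (fun _ hu => hX.hasDerivAt_tangentCoord hu)

theorem tendsto_chord_sq_div (hX : IsStrictlyLocallyConvex I X N) (hs : s ∈ I) :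
    Tendsto (fun h => chord I X N s h ^ 2 / h) (𝓝[>] 0)
      (𝓝 (8 * ⟪deriv X s, deriv X s⟫ ^ 2 / ⟪deriv (deriv X) s, N s⟫)) :=
  tendsto_chordLength_sq_div hX.isOpen hs (fun _ hu => hX.hasDerivAt_normalCoord (s := s) hu)
    (hX.continuousOn_inner_deriv (N s)) normalCoord_self (hX.inner_normal s hs)
    (hX.hasDerivAt_inner_deriv hs (N s)) (hX.inner_deriv_deriv_normal_pos hs)
    (hX.hasDerivAt_tangentCoord hs) tangentCoord_self

theorem tendsto_chord_div_chordDeriv_div (hX : IsStrictlyLocallyConvex I X N) (hs : s ∈ I) :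
    Tendsto (fun h => chord I X N s h / chordDeriv I X N s h / h) (𝓝[>] 0) (𝓝 2) :=
  tendsto_chordLength_div_deriv (x' := fun u => ⟪deriv X u, deriv X s⟫) hX.isOpen hs
    (fun _ hu => hX.hasDerivAt_normalCoord (s := s) hu)
    (hX.continuousOn_inner_deriv (N s)) normalCoord_self (hX.inner_normal s hs)
    (hX.hasDerivAt_inner_deriv hs (N s)) (hX.inner_deriv_deriv_normal_pos hs)
    (hX.hasDerivAt_tangentCoord hs) tangentCoord_self
    (hX.hasDerivAt_inner_deriv hs _).continuousAt (hX.inner_deriv_self_pos hs)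

/-- The distance of the centroid from the chord line in terms of the chord length `L`:
it is `L / (3 L')`. -/
theorem distJ_eq (hX : IsStrictlyLocallyConvex I X N) (hs : s ∈ I) :
    ∀ᶠ h in 𝓝[>] (0 : ℝ),
      distJ I X N s h = chord I X N s h / chordDeriv I X N s h / 3 := by
  filter_upwards [(hX.paramA_spec hs).1, (hX.paramB_spec hs).1, hX.chord_pos hs,
    hX.chordDeriv_pos hs] with h ⟨ha, ha1, ha2⟩ ⟨hb, hb1, hb2⟩ hL hL'
  have hLe := hX.chord_eq hs h
  have hLe' : chordDeriv I X N s h =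
      ⟪deriv X (paramB I X N s h), deriv X s⟫ / ⟪deriv X (paramB I X N s h), N s⟫ -
      ⟪deriv X (paramA I X N s h), deriv X s⟫ / ⟪deriv X (paramA I X N s h), N s⟫ := by
    rw [chordDeriv, chordLengthDeriv, hX.paramA_eq hs, hX.paramB_eq hs]
  rw [distJ, infDist_chordLine (hX.norm_normal s hs) (hX.regular s hs) (hX.inner_normal s hs),
    centroidJ, pointA, pointB, pointQ]
  set a := paramA I X N s h
  set b := paramB I X N s h
  set L := chord I X N s h
  set L' := chordDeriv I X N s h
  -- The point of the tangent at `B` at signed height `e` over `ℓ` has tangential coordinate that of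
  -- `B` plus `e` times the inverse slope; likewise at `A`. The two agree when `L + e L' = 0`, which
  -- dictates the witness. Existence is what gives the choice in `pointQ` a meaning.
  have hq : ∃ q : Plane, q ∈ tangentLine X a ∧ q ∈ tangentLine X b := by
    refine ⟨X a + (-(L / L') / ⟪deriv X a, N s⟫) • deriv X a, mem_tangentLine_iff.2 ⟨_, rfl⟩,
      mem_tangentLine_iff.2 ⟨-(L / L') / ⟪deriv X b, N s⟫, ?_⟩⟩
    rw [← sub_eq_zero]
    apply eq_zero_of_inner_eq_zero (hX.normal_ne_zero hs) (hX.regular s hs) (hX.inner_normal s hs)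
    · simp only [normalCoord, inner_sub_left] at ha1 hb1
      simp only [inner_sub_left, inner_add_left, real_inner_smul_left]
      rw [div_mul_cancel₀ _ ha2.ne, div_mul_cancel₀ _ hb2.ne']
      linarith
    · simp only [tangentCoord, inner_sub_left] at hLe
      simp only [inner_sub_left, inner_add_left, real_inner_smul_left]
      have h1 : L / L' * (⟪deriv X b, deriv X s⟫ / ⟪deriv X b, N s⟫ -
          ⟪deriv X a, deriv X s⟫ / ⟪deriv X a, N s⟫) = L := by
        rw [← hLe', div_mul_cancel₀ _ hL'.ne']
      linear_combination h1 + hLe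
  obtain ⟨hqa, hqb⟩ := Classical.epsilon_spec hq
  set q := Classical.epsilon fun q : Plane => q ∈ tangentLine X a ∧ q ∈ tangentLine X b
  obtain ⟨l, hl⟩ := mem_tangentLine_iff.1 hqa
  obtain ⟨m, hm⟩ := mem_tangentLine_iff.1 hqb
  have hlN : ⟪q - X s, N s⟫ = h + l * ⟪deriv X a, N s⟫ := by
    rw [← ha1, hl, normalCoord, add_sub_right_comm, inner_add_left, real_inner_smul_left]
  have hmN : ⟪q - X s, N s⟫ = h + m * ⟪deriv X b, N s⟫ := by
    rw [← hb1, hm, normalCoord, add_sub_right_comm, inner_add_left, real_inner_smul_left]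
  have hlT : ⟪q - X s, deriv X s⟫ = tangentCoord X s a + l * ⟪deriv X a, deriv X s⟫ := by
    rw [hl, tangentCoord, add_sub_right_comm, inner_add_left, real_inner_smul_left]
  have hmT : ⟪q - X s, deriv X s⟫ = tangentCoord X s b + m * ⟪deriv X b, deriv X s⟫ := by
    rw [hm, tangentCoord, add_sub_right_comm, inner_add_left, real_inner_smul_left]
  set e := ⟪q - X s, N s⟫ - h with he
  have hl' : l = e / ⟪deriv X a, N s⟫ := by
    rw [eq_div_iff ha2.ne]; linarith
  have hm' : m = e / ⟪deriv X b, N s⟫ := by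
    rw [eq_div_iff hb2.ne']; linarith
  -- Any common point of the two tangents is at this height, so the choice made by
  -- `Classical.epsilon` is immaterial.
  have hk : e = -(L / L') := by
    rw [← neg_div, eq_div_iff hL'.ne', hLe', hLe]
    rw [hl'] at hlT
    rw [hm'] at hmT
    linear_combination hlT - hmT
  -- `A` and `B` lie on `ℓ`, so only `Q` contributes to the height of the centroid over `ℓ`.
  have hJ : ⟪(1 / 3 : ℝ) • (q + X a + X b) - X s, N s⟫ - h = e / 3 := by
    have : (1 / 3 : ℝ) • (q + X a + X b) - X s =
        (1 / 3 : ℝ) • ((q - X s) + (X a - X s) + (X b - X s)) := by module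
    rw [this, real_inner_smul_left, inner_add_left, inner_add_left]
    rw [normalCoord] at ha1 hb1
    rw [ha1, hb1, he]
    ring
  rw [hJ, hk, neg_div, abs_neg, abs_of_pos (by positivity)]

/-- The centroid distance is asymptotic to `2 h / 3`. -/
theorem tendsto_distJ_div (hX : IsStrictlyLocallyConvex I X N) (hs : s ∈ I) :
    Tendsto (fun h => distJ I X N s h / h) (𝓝[>] 0) (𝓝 (2 / 3)) := by
  refine ((hX.tendsto_chord_div_chordDeriv_div hs).div_const 3).congr' ?_
  filter_upwards [hX.distJ_eq hs] with h hh
  rw [hh, div_right_comm]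

/-- The limit `2 / 3` of `j / h` leaves no freedom for either the coefficient or the exponent. -/
theorem eventually_distJ_of_eq_mul_rpow (hX : IsStrictlyLocallyConvex I X N) (hs : s ∈ I)
    {l m : ℝ} (h : ∀ᶠ h in 𝓝[>] (0 : ℝ), distJ I X N s h = l * h ^ m) :
    ∀ᶠ h in 𝓝[>] (0 : ℝ), distJ I X N s h = 2 / 3 * h := by
  obtain ⟨rfl, rfl⟩ := eq_of_tendsto_mul_rpow_div (l := l) (m := m) (r := 2 / 3) (by norm_num)
    ((hX.tendsto_distJ_div hs).congr' (h.mono fun h hh => by rw [hh]))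
  simpa using h

theorem chord_sq_eq_of_distJ (hX : IsStrictlyLocallyConvex I X N) (hs : s ∈ I)
    (h : ∀ᶠ h in 𝓝[>] (0 : ℝ), distJ I X N s h = 2 / 3 * h) :
    ∀ᶠ h in 𝓝[>] (0 : ℝ), chord I X N s h ^ 2 =
      8 * ⟪deriv X s, deriv X s⟫ ^ 2 / ⟪deriv (deriv X) s, N s⟫ * h := by
  refine eventually_sq_eq_mul_of_div_deriv (hX.hasDerivAt_chord hs) (hX.chordDeriv_pos hs)
    (hX.tendsto_chord_sq_div hs) ?_
  filter_upwards [h, hX.distJ_eq hs] with h h1 h2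
  linarith

theorem distJ_of_chord_sq_eq (hX : IsStrictlyLocallyConvex I X N) (hs : s ∈ I) {C : ℝ}
    (h : ∀ᶠ h in 𝓝[>] (0 : ℝ), chord I X N s h ^ 2 = C * h) :
    ∀ᶠ h in 𝓝[>] (0 : ℝ), distJ I X N s h = 2 / 3 * h := by
  filter_upwards [hX.distJ_eq hs, eventually_div_deriv_of_sq_eq_mul (hX.hasDerivAt_chord hs)
    (hX.chordDeriv_pos hs) h (hX.chord_pos hs)] with h h1 h2
  linarith

end IsStrictlyLocallyConvex

/-! ### Comparison with conics -/

/-- The mean value theorem between a fixed point `s` and a point on either side of it. -/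
theorem exists_deriv_eq_slope_of_ne {f f' : ℝ → ℝ} {s d u : ℝ}
    (hf : ∀ v ∈ Set.Ioo (s - d) (s + d), HasDerivAt f (f' v) v)
    (hu : u ∈ Set.Ioo (s - d) (s + d)) (hus : u ≠ s) :
    ∃ c ∈ Set.Ioo (s - d) (s + d), 0 < (c - s) * (u - s) ∧ f u - f s = f' c * (u - s) := by
  have hd : 0 < d := by linarith [hu.1, hu.2]
  rcases lt_or_gt_of_ne hus with h | h
  · obtain ⟨c, hc, hc'⟩ := exists_hasDerivAt_eq_slope f f' h
      (fun v hv => (hf v ⟨hu.1.trans_le hv.1, by linarith [hv.2]⟩).continuousAt.continuousWithinAt)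
      (fun v hv => hf v ⟨hu.1.trans hv.1, by linarith [hv.2]⟩)
    refine ⟨c, ⟨hu.1.trans hc.1, by linarith [hc.2]⟩,
      mul_pos_of_neg_of_neg (sub_neg.2 hc.2) (sub_neg.2 h), ?_⟩
    rw [hc']
    have : s - u ≠ 0 := (sub_pos.2 h).ne'
    field_simp
    ring
  · obtain ⟨c, hc, hc'⟩ := exists_hasDerivAt_eq_slope f f' h
      (fun v hv => (hf v ⟨by linarith [hv.1], hv.2.trans_lt hu.2⟩).continuousAt.continuousWithinAt)
      (fun v hv => hf v ⟨by linarith [hv.1], hv.2.trans hu.2⟩)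
    refine ⟨c, ⟨by linarith [hc.1], hc.2.trans hu.2⟩,
      mul_pos (sub_pos.2 hc.1) (sub_pos.2 h), ?_⟩
    rw [hc', div_mul_cancel₀ _ (sub_pos.2 h).ne']

theorem exists_Ioo_of_eventually {p : ℝ → Prop} {s : ℝ} (h : ∀ᶠ u in 𝓝 s, p u) :
    ∃ d > 0, ∀ u ∈ Set.Ioo (s - d) (s + d), p u := by
  obtain ⟨d, hd, h⟩ := Metric.eventually_nhds_iff_ball.1 h
  exact ⟨d, hd, fun u hu => h u (by rwa [Real.ball_eq_Ioo])⟩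

/-- If `w' = x' v` with `x' > 0`, `v' ≥ 0` and `w`, `v` vanish at `s`, then `w ≥ 0` near `s`. -/
theorem eventually_nonneg_of_deriv_eq_mul {w x' v v' : ℝ → ℝ} {s : ℝ}
    (hw : ∀ᶠ u in 𝓝 s, HasDerivAt w (x' u * v u) u) (hv : ∀ᶠ u in 𝓝 s, HasDerivAt v (v' u) u)
    (hx' : ∀ᶠ u in 𝓝 s, 0 < x' u) (hv' : ∀ᶠ u in 𝓝 s, 0 ≤ v' u) (hws : w s = 0)
    (hvs : v s = 0) : ∀ᶠ u in 𝓝 s, 0 ≤ w u := by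
  obtain ⟨d, hd, H⟩ := exists_Ioo_of_eventually (hw.and (hv.and (hx'.and hv')))
  filter_upwards [Ioo_mem_nhds (sub_lt_self s hd) (lt_add_of_pos_right s hd)] with u hu
  rcases eq_or_ne u s with rfl | hus
  · exact hws.ge
  obtain ⟨c, hc, hcu, hc'⟩ := exists_deriv_eq_slope_of_ne (fun v hv => (H v hv).1) hu hus
  have hcs : c ≠ s := by rintro rfl; simp at hcu
  obtain ⟨e, he, hec, he'⟩ := exists_deriv_eq_slope_of_ne (fun v hv => (H v hv).2.1) hc hcs
  rw [hws, sub_zero] at hc'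
  rw [hvs, sub_zero] at he'
  rw [hc', he']
  have h1 := (H c hc).2.2.1
  have h2 := (H e he).2.2.2
  have : x' c * (v' e * (c - s)) * (u - s) = x' c * v' e * ((c - s) * (u - s)) := by ring
  rw [this]
  positivity

section Conic

variable {x x' y r ψ : ℝ → ℝ} {s : ℝ}

/-- Comparison of a curve `(x, y)` with the conic that has the same tangent and the same `ψ` at
`s`, where `ψ ^ (-3)` is the second derivative of `y` with respect to `x`. -/
theorem eventually_conic_comparison (hx : ∀ᶠ u in 𝓝 s, HasDerivAt x (x' u) u)
    (hy : ∀ᶠ u in 𝓝 s, HasDerivAt y (r u * x' u) u)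
    (hr : ∀ᶠ u in 𝓝 s, HasDerivAt r (x' u / ψ u ^ 3) u)
    (hx' : ∀ᶠ u in 𝓝 s, 0 < x' u) (hψ : ∀ᶠ u in 𝓝 s, 0 < ψ u) {q ε κ : ℝ}
    (hQ : ∀ᶠ u in 𝓝 s,
      0 ≤ κ * (ψ s ^ 2 + 2 * q * (x u - x s) - ε * (x u - x s) ^ 2 - ψ u ^ 2)) :
    ∀ᶠ u in 𝓝 s, 0 < ψ s ^ 2 + 2 * q * (x u - x s) - ε * (x u - x s) ^ 2 ∧
      0 ≤ κ * (q ^ 2 + ε * ψ s ^ 2) *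
        ((q ^ 2 + ε * ψ s ^ 2) * (y u - y s - r s * (x u - x s)) -
          (ψ s + q * (x u - x s) / ψ s -
            √(ψ s ^ 2 + 2 * q * (x u - x s) - ε * (x u - x s) ^ 2))) := by
  set m := ψ s with hm
  -- For `D ≠ 0`, differentiating twice in `t` gives `(√Q)'' = -D / Q ^ (3/2)`, so `(m + q t / m -
  -- √Q) / D` solves `y'' = Q ^ (-3/2)` and vanishes with its slope at `t = 0`. Its graph is an arc
  -- of a conic.
  set D := q ^ 2 + ε * m ^ 2 with hD
  have mpos : 0 < m := hψ.self_of_nhds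
  set Q : ℝ → ℝ := fun u => m ^ 2 + 2 * q * (x u - x s) - ε * (x u - x s) ^ 2 with hQdef
  have hxs : ContinuousAt x s := hx.self_of_nhds.continuousAt
  have hQpos : ∀ᶠ u in 𝓝 s, 0 < Q u := by
    have hc : ContinuousAt Q s := by
      simp only [hQdef]; fun_prop
    apply hc.eventually (lt_mem_nhds _)
    simp only [hQdef, sub_self]
    simp [mpos]
  have hQs : Q s = m ^ 2 := by simp [hQdef]
  have hQ' : ∀ᶠ u in 𝓝 s, HasDerivAt Q (2 * (q - ε * (x u - x s)) * x' u) u := by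
    filter_upwards [hx] with u hu
    have h1 := hu.sub_const (x s)
    refine (((h1.const_mul (2 * q)).const_add (m ^ 2)).sub ((h1.pow 2).const_mul ε)).congr_deriv ?_
    push_cast
    ring
  refine hQpos.and ?_
  -- `v` is the derivative with respect to `x` of the claimed quantity. The outer factor `κ D` turns
  -- the `D` in `v'` into `D ^ 2`, so that only the sign of `κ (√Q - ψ)` matters.
  refine eventually_nonneg_of_deriv_eq_mul (x' := x')
    (v := fun u => κ * D * (D * (r u - r s) - q / m + (q - ε * (x u - x s)) / √(Q u)))
    (v' := fun u => κ * D * (D * (x' u / ψ u ^ 3) - x' u * D / √(Q u) ^ 3)) ?_ ?_ hx' ?_ ?_ ?_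
  · filter_upwards [hx, hy, hQ', hQpos] with u h1 h2 h3 h4
    have h5 := h1.sub_const (x s)
    have h6 := ((((h2.sub_const (y s)).sub (h5.const_mul (r s))).const_mul D).sub
      ((((h5.const_mul q).div_const m).const_add m).sub (h3.sqrt h4.ne'))).const_mul (κ * D)
    refine h6.congr_deriv ?_
    have : √(Q u) ≠ 0 := (Real.sqrt_pos.2 h4).ne'
    field_simp
    ring
  · filter_upwards [hx, hr, hQ', hQpos] with u h1 h2 h3 h4
    have h5 := h1.sub_const (x s)
    have hS : √(Q u) ≠ 0 := (Real.sqrt_pos.2 h4).ne'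
    have h6 := (((((h2.sub_const (r s)).const_mul D).sub_const (q / m))).add
      (((h5.const_mul ε).const_sub q).div (h3.sqrt h4.ne') hS)).const_mul (κ * D)
    refine h6.congr_deriv ?_
    have hS2 : √(Q u) ^ 2 = Q u := Real.sq_sqrt h4.le
    have hDQ : ε * √(Q u) ^ 2 + (q - ε * (x u - x s)) ^ 2 = D := by
      rw [hS2, hD, hQdef]; ring
    rw [sub_eq_add_neg (D * (x' u / ψ u ^ 3))]
    congr 2
    rw [← hDQ]
    field_simp
    ring
  · filter_upwards [hQ, hQpos, hψ, hx'] with u h1 h2 h3 h4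
    have h1 : 0 ≤ κ * (Q u - ψ u ^ 2) := h1
    have hS : 0 < √(Q u) := Real.sqrt_pos.2 h2
    have hS2 : √(Q u) ^ 2 = Q u := Real.sq_sqrt h2.le
    rw [← hS2] at h1
    have h5 : 0 ≤ κ * (√(Q u) - ψ u) := by
      have : κ * (√(Q u) ^ 2 - ψ u ^ 2) = κ * (√(Q u) - ψ u) * (√(Q u) + ψ u) := by ring
      rw [this] at h1
      exact nonneg_of_mul_nonneg_left h1 (by positivity)
    have h6 : κ * D * (D * (x' u / ψ u ^ 3) - x' u * D / √(Q u) ^ 3) =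
        D ^ 2 * x' u * (κ * (√(Q u) - ψ u)) * (√(Q u) ^ 2 + √(Q u) * ψ u + ψ u ^ 2) /
          (ψ u ^ 3 * √(Q u) ^ 3) := by
      field_simp
      ring
    rw [h6]
    positivity
  · simp [Real.sqrt_sq mpos.le]
  · simp [hQs, Real.sqrt_sq mpos.le]

/-- A chord property at `s` is incompatible with `ψ ^ 2` being touched at `s`, as a function of
`x`, by a parabola that opens strictly to the appropriate side. -/
theorem false_of_touching_of_ne (hx : ∀ᶠ u in 𝓝 s, HasDerivAt x (x' u) u)
    (hy : ∀ᶠ u in 𝓝 s, HasDerivAt y (r u * x' u) u)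
    (hr : ∀ᶠ u in 𝓝 s, HasDerivAt r (x' u / ψ u ^ 3) u)
    (hx' : ∀ᶠ u in 𝓝 s, 0 < x' u) (hψ : ∀ᶠ u in 𝓝 s, 0 < ψ u)
    (hchord : ∀ δ > 0, ∃ H ∈ Set.Ioo 0 δ, ∃ a ∈ Set.Ioo (s - δ) s, ∃ b ∈ Set.Ioo s (s + δ),
      y a - y s - r s * (x a - x s) = H ∧ y b - y s - r s * (x b - x s) = H ∧
      (x b - x a) ^ 2 = 8 * H * ψ s ^ 3) {q ε κ : ℝ} (hκ : κ = 1 ∨ κ = -1)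
    (hε : 0 < κ * ε) (hD : q ^ 2 + ε * ψ s ^ 2 ≠ 0)
    (hQ : ∀ᶠ u in 𝓝 s,
      0 ≤ κ * (ψ s ^ 2 + 2 * q * (x u - x s) - ε * (x u - x s) ^ 2 - ψ u ^ 2)) : False := by
  have hcmp := eventually_conic_comparison hx hy hr hx' hψ hQ
  have mpos : 0 < ψ s := hψ.self_of_nhds
  have hxs : ContinuousAt x s := hx.self_of_nhds.continuousAt
  have hsmall : ∀ᶠ u in 𝓝 s, 0 < ψ s / 2 + q * (x u - x s) / ψ s := by
    have hc : ContinuousAt (fun u => ψ s / 2 + q * (x u - x s) / ψ s) s := by fun_prop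
    apply hc.eventually (lt_mem_nhds _)
    simp [mpos]
  obtain ⟨d, hd, H0⟩ := exists_Ioo_of_eventually (hcmp.and (hsmall.and (hx.and hx')))
  set m := ψ s with hm
  set D := q ^ 2 + ε * m ^ 2 with hDdef
  -- Heights below the second bound satisfy `D H < m / 2`. With `hsmall` this makes `m + q t / m - D
  -- H` positive, so the comparison with `√Q` can be squared.
  have hδ : 0 < min d (m / (2 * (|D| + 1))) := lt_min hd (by positivity)
  obtain ⟨H, hH, a, ha, b, hb, hya, hyb, hab⟩ := hchord _ hδ
  have hHpos := hH.1
  have hDH : D * H < m / 2 := by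
    have h1 : H < m / (2 * (|D| + 1)) := hH.2.trans_le (min_le_right _ _)
    rw [lt_div_iff₀ (by positivity)] at h1
    have := le_abs_self D
    nlinarith
  have hmin : min d (m / (2 * (|D| + 1))) ≤ d := min_le_left _ _
  have haI : a ∈ Set.Ioo (s - d) (s + d) := ⟨by linarith [ha.1], by linarith [ha.2]⟩
  have hbI : b ∈ Set.Ioo (s - d) (s + d) := ⟨by linarith [hb.1], by linarith [hb.2]⟩
  -- the sign of the conic's equation at a point of height `H`
  have hZ : ∀ u ∈ Set.Ioo (s - d) (s + d), y u - y s - r s * (x u - x s) = H →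
      κ * ((x u - x s - q * m * H) ^ 2 - (2 * m ^ 3 * H - ε * m ^ 4 * H ^ 2)) ≤ 0 := by
    intro u hu hyu
    obtain ⟨⟨hpos, hw⟩, hR, -⟩ := H0 u hu
    rw [hyu] at hw
    set t := x u - x s
    set S := √(m ^ 2 + 2 * q * t - ε * t ^ 2) with hS
    have hS2 : S ^ 2 = m ^ 2 + 2 * q * t - ε * t ^ 2 := Real.sq_sqrt hpos.le
    have hSpos : 0 < S := Real.sqrt_pos.2 hpos
    have hRpos : 0 < m + q * t / m - D * H := by linarith
    have h1 : 0 ≤ κ * D * (D * H - (m + q * t / m - S)) * (S + (m + q * t / m - D * H)) :=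
      mul_nonneg hw (by positivity)
    have h2 : κ * D * (D * H - (m + q * t / m - S)) * (S + (m + q * t / m - D * H)) =
        -(D ^ 2 / m ^ 2) *
          (κ * ((t - q * m * H) ^ 2 - (2 * m ^ 3 * H - ε * m ^ 4 * H ^ 2))) := by
      have : κ * D * (D * H - (m + q * t / m - S)) * (S + (m + q * t / m - D * H)) =
        κ * D * (S ^ 2 - (m + q * t / m - D * H) ^ 2) := by ring
      rw [this, hS2]
      field_simp
      rw [hDdef]
      ring
    rw [h2] at h1
    have h3 : 0 < D ^ 2 / m ^ 2 := by positivity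
    by_contra hlt
    push Not at hlt
    linarith [mul_pos h3 hlt]
  have hxmono : StrictMonoOn x (Set.Ioo (s - d) (s + d)) := by
    apply strictMonoOn_of_deriv_pos (convex_Ioo _ _)
    · exact fun u hu => (H0 u hu).2.2.1.continuousAt.continuousWithinAt
    · intro u hu
      rw [interior_Ioo] at hu
      rw [(H0 u hu).2.2.1.deriv]
      exact (H0 u hu).2.2.2
  have hsI : s ∈ Set.Ioo (s - d) (s + d) := ⟨by linarith, by linarith⟩
  have hta : x a - x s < 0 := sub_neg.2 (hxmono haI hsI ha.2)
  have htb : 0 < x b - x s := sub_pos.2 (hxmono hsI hbI hb.1)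
  have hZa := hZ a haI hya
  have hZb := hZ b hbI hyb
  have hab' : ((x b - x s) - (x a - x s)) ^ 2 = 8 * H * m ^ 3 := by
    rw [← hab]; ring
  generalize x a - x s = ta at *
  generalize x b - x s = tb at *
  have hm4 : 0 < m ^ 4 * H ^ 2 := by positivity
  -- Put `c = q m H` and `E = 2 m³ H - ε m⁴ H²`; the conic has height `H` where `(t - c)² = E`. For
  -- `κ = 1` both ends satisfy `(t - c)² ≤ E`, so the squared chord is at most `4 E < 8 H m³`. For
  -- `κ = -1` these inequalities are reversed.
  rcases hκ with rfl | rfl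
  · have h1 : 0 < ε * (m ^ 4 * H ^ 2) := mul_pos (by linarith) hm4
    linarith [sq_nonneg ((tb - q * m * H) + (ta - q * m * H))]
  · have h1 : ε * (m ^ 4 * H ^ 2) < 0 := mul_neg_of_neg_of_pos (by linarith) hm4
    set E := 2 * m ^ 3 * H - ε * m ^ 4 * H ^ 2 with hE
    set c := q * m * H with hc
    -- This puts `0` strictly between `c - √E` and `c + √E`. As `ta < 0 < tb`, the two ends lie
    -- beyond different roots and the squared chord is at least `4 E > 8 H m³`.
    have hc2 : c ^ 2 < E := by
      have h2 : m ^ 2 * H * (D * H) < m ^ 2 * H * (2 * m) := by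
        apply mul_lt_mul_of_pos_left _ (by positivity)
        linarith
      rw [hE, hc]
      rw [hDdef] at h2
      linarith
    have hE0 : 0 < E := lt_of_le_of_lt (sq_nonneg c) hc2
    have hcE := abs_lt.1 ((Real.sqrt_sq_eq_abs c).symm.trans_lt (Real.sqrt_lt_sqrt (sq_nonneg c) hc2))
    have h2 : √E ≤ tb - c := by
      have h3 : √E ≤ |tb - c| := Real.sqrt_le_sqrt (by linarith) |>.trans_eq (Real.sqrt_sq_eq_abs _)
      rcases le_total 0 (tb - c) with h4 | h4
      · rwa [abs_of_nonneg h4] at h3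
      · rw [abs_of_nonpos h4] at h3; linarith
    have h3 : √E ≤ c - ta := by
      have h3 : √E ≤ |ta - c| := Real.sqrt_le_sqrt (by linarith) |>.trans_eq (Real.sqrt_sq_eq_abs _)
      rcases le_total 0 (ta - c) with h4 | h4
      · rw [abs_of_nonneg h4] at h3; linarith
      · rw [abs_of_nonpos h4] at h3; linarith
    have h4 : (2 * √E) ^ 2 ≤ (tb - ta) ^ 2 :=
      pow_le_pow_left₀ (by positivity) (by linarith) 2
    rw [mul_pow, Real.sq_sqrt hE0.le, hab', hE] at h4
    linarith

/-- The conic comparison carries no information when `q ^ 2 + ε * ψ s ^ 2 = 0`. Halving `ε` leaves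
that case, while the touching inequality only gains the nonnegative term `κ ε t² / 2`. -/
theorem false_of_touching (hx : ∀ᶠ u in 𝓝 s, HasDerivAt x (x' u) u)
    (hy : ∀ᶠ u in 𝓝 s, HasDerivAt y (r u * x' u) u)
    (hr : ∀ᶠ u in 𝓝 s, HasDerivAt r (x' u / ψ u ^ 3) u)
    (hx' : ∀ᶠ u in 𝓝 s, 0 < x' u) (hψ : ∀ᶠ u in 𝓝 s, 0 < ψ u)
    (hchord : ∀ δ > 0, ∃ H ∈ Set.Ioo 0 δ, ∃ a ∈ Set.Ioo (s - δ) s, ∃ b ∈ Set.Ioo s (s + δ),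
      y a - y s - r s * (x a - x s) = H ∧ y b - y s - r s * (x b - x s) = H ∧
      (x b - x a) ^ 2 = 8 * H * ψ s ^ 3) {q ε κ : ℝ} (hκ : κ = 1 ∨ κ = -1)
    (hε : 0 < κ * ε)
    (hQ : ∀ᶠ u in 𝓝 s,
      0 ≤ κ * (ψ s ^ 2 + 2 * q * (x u - x s) - ε * (x u - x s) ^ 2 - ψ u ^ 2)) : False := by
  by_cases hD : q ^ 2 + ε * ψ s ^ 2 = 0
  · have mpos : 0 < ψ s := hψ.self_of_nhds
    have hε0 : ε ≠ 0 := by rintro rfl; simp at hε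
    refine false_of_touching_of_ne (q := q) (ε := ε / 2) hx hy hr hx' hψ hchord hκ
      (by linarith) ?_ ?_
    · have : ε * ψ s ^ 2 ≠ 0 := by positivity
      intro h
      apply this
      linarith
    · filter_upwards [hQ] with u hu
      have := mul_nonneg hε.le (sq_nonneg (x u - x s))
      linarith
  · exact false_of_touching_of_ne hx hy hr hx' hψ hchord hκ hε hD hQ

end Conic

/-! ### The maximum principle for `ψ ^ 2` -/

/-- If every point has the chord property, then `ψ ^ 2` is an affine function of `x`. -/
theorem sq_affine_of_chord {J : Set ℝ} {x x' y r ψ : ℝ → ℝ} (hJ : IsOpen J) (hJ' : J.OrdConnected)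
    (hx : ∀ u ∈ J, HasDerivAt x (x' u) u) (hy : ∀ u ∈ J, HasDerivAt y (r u * x' u) u)
    (hr : ∀ u ∈ J, HasDerivAt r (x' u / ψ u ^ 3) u) (hx' : ∀ u ∈ J, 0 < x' u)
    (hψ : ∀ u ∈ J, 0 < ψ u) (hψc : ContinuousOn ψ J)
    (hchord : ∀ s ∈ J, ∀ δ > 0, ∃ H ∈ Set.Ioo 0 δ, ∃ a ∈ Set.Ioo (s - δ) s,
      ∃ b ∈ Set.Ioo s (s + δ), y a - y s - r s * (x a - x s) = H ∧
      y b - y s - r s * (x b - x s) = H ∧ (x b - x a) ^ 2 = 8 * H * ψ s ^ 3)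
    {α β : ℝ} (hα : α ∈ J) (hβ : β ∈ J) (hαβ : α < β) :
    ∃ k : ℝ, ∀ u ∈ Set.Icc α β, ψ u ^ 2 = ψ α ^ 2 + k * (x u - x α) := by
  have hsub : Set.Icc α β ⊆ J := hJ'.out hα hβ
  have hxc : ContinuousOn x (Set.Icc α β) := fun u hu =>
    (hx u (hsub hu)).continuousAt.continuousWithinAt
  have hxαβ : x α < x β := by
    have : StrictMonoOn x (Set.Icc α β) := by
      apply strictMonoOn_of_deriv_pos (convex_Icc _ _) hxc
      intro u hu
      have hu := hsub (interior_subset hu)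
      rw [(hx u hu).deriv]
      exact hx' u hu
    exact this (Set.left_mem_Icc.2 hαβ.le) (Set.right_mem_Icc.2 hαβ.le) hαβ
  set k := (ψ β ^ 2 - ψ α ^ 2) / (x β - x α) with hk
  set ℓ : ℝ → ℝ := fun u => ψ α ^ 2 + k * (x u - x α) with hℓ
  have hℓα : ℓ α = ψ α ^ 2 := by simp [hℓ]
  have hℓβ : ℓ β = ψ β ^ 2 := by
    simp only [hℓ, hk]
    rw [div_mul_cancel₀ _ (sub_pos.2 hxαβ).ne']
    ring
  -- The two signs of `κ` bound `ψ ^ 2` by its affine interpolant `ℓ` from above and from below. If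
  -- a bound fails at `m`, a small quadratic added to `κ (ψ ^ 2 - ℓ)` still leaves an interior
  -- maximum, and there `ψ ^ 2` is touched by a strictly curved parabola.
  have key : ∀ κ : ℝ, κ = 1 ∨ κ = -1 → ∀ m ∈ Set.Icc α β, κ * (ψ m ^ 2 - ℓ m) ≤ 0 := by
    intro κ hκ m hm
    by_contra hpos
    push Not at hpos
    set η₀ := κ * (ψ m ^ 2 - ℓ m) with hη₀
    -- With `ε M = η₀` the quadratic stays below `η₀ = F m` at both ends, where the rest of `F`
    -- vanishes.
    set M := (x α - x m) ^ 2 + (x β - x m) ^ 2 + 1 with hM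
    have hMpos : 0 < M := by positivity
    set ε := η₀ / M with hε
    have hεpos : 0 < ε := div_pos hpos hMpos
    have hεM : ε * M = η₀ := div_mul_cancel₀ _ hMpos.ne'
    set F : ℝ → ℝ := fun u => κ * (ψ u ^ 2 - ℓ u) + ε * (x u - x m) ^ 2 with hF
    have hFc : ContinuousOn F (Set.Icc α β) := by
      have h1 : ContinuousOn ψ (Set.Icc α β) := hψc.mono hsub
      simp only [hF, hℓ]
      fun_prop
    obtain ⟨s, hs, hmax⟩ := isCompact_Icc.exists_isMaxOn ⟨m, hm⟩ hFc
    have hFm : F m = η₀ := by simp [hF, hη₀]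
    have hFα : F α < η₀ := by
      simp only [hF, hℓα, sub_self, mul_zero, zero_add]
      rw [← hεM]
      apply mul_lt_mul_of_pos_left _ hεpos
      rw [hM]; linarith [sq_nonneg (x β - x m)]
    have hFβ : F β < η₀ := by
      simp only [hF, hℓβ, sub_self, mul_zero, zero_add]
      rw [← hεM]
      apply mul_lt_mul_of_pos_left _ hεpos
      rw [hM]; linarith [sq_nonneg (x α - x m)]
    have hFs : η₀ ≤ F s := hFm ▸ hmax hm
    have hsα : α < s := lt_of_le_of_ne hs.1 (by rintro rfl; linarith)
    have hsβ : s < β := lt_of_le_of_ne hs.2 (by rintro rfl; linarith)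
    have hsJ : s ∈ J := hsub hs
    have hev : ∀ᶠ u in 𝓝 s, u ∈ J := hJ.eventually_mem hsJ
    have hκ2 : κ * κ = 1 := by rcases hκ with rfl | rfl <;> norm_num
    -- `2 q` is the coefficient of `x u - x s` when `ℓ` and the added quadratic are expanded around
    -- `s`.
    refine false_of_touching (q := (k - 2 * κ * ε * (x s - x m)) / 2) (ε := κ * ε)
      (hev.mono hx) (hev.mono hy) (hev.mono hr) (hev.mono hx')
      (hev.mono hψ) (hchord s hsJ) hκ (by rw [← mul_assoc, hκ2, one_mul]; exact hεpos) ?_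
    filter_upwards [Icc_mem_nhds hsα hsβ] with u hu
    have h1 : F u ≤ F s := hmax hu
    simp only [hF, hℓ] at h1
    have h2 : κ * (ψ s ^ 2 + 2 * ((k - 2 * κ * ε * (x s - x m)) / 2) * (x u - x s) -
        κ * ε * (x u - x s) ^ 2 - ψ u ^ 2) =
        κ * (ψ s ^ 2 + k * (x u - x s) - ψ u ^ 2) -
          κ * κ * (ε * (2 * (x s - x m) * (x u - x s) + (x u - x s) ^ 2)) := by ring
    rw [h2, hκ2]
    linarith
  refine ⟨k, fun u hu => ?_⟩
  have h1 := key 1 (Or.inl rfl) u hu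
  have h2 := key (-1) (Or.inr rfl) u hu
  simp only [hℓ] at h1 h2
  linarith

/-- If every point has the chord property, then the derivative of `ψ ^ 2` with respect to `x` is
constant. -/
theorem deriv_sq_div_eq_of_chord {J : Set ℝ} {x x' y r ψ ψ' : ℝ → ℝ} (hJ : IsOpen J)
    (hJ' : J.OrdConnected)
    (hx : ∀ u ∈ J, HasDerivAt x (x' u) u) (hy : ∀ u ∈ J, HasDerivAt y (r u * x' u) u)
    (hr : ∀ u ∈ J, HasDerivAt r (x' u / ψ u ^ 3) u) (hx' : ∀ u ∈ J, 0 < x' u)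
    (hψ : ∀ u ∈ J, 0 < ψ u) (hψd : ∀ u ∈ J, HasDerivAt ψ (ψ' u) u)
    (hchord : ∀ s ∈ J, ∀ δ > 0, ∃ H ∈ Set.Ioo 0 δ, ∃ a ∈ Set.Ioo (s - δ) s,
      ∃ b ∈ Set.Ioo s (s + δ), y a - y s - r s * (x a - x s) = H ∧
      y b - y s - r s * (x b - x s) = H ∧ (x b - x a) ^ 2 = 8 * H * ψ s ^ 3)
    {u v : ℝ} (hu : u ∈ J) (hv : v ∈ J) :
    ψ u * ψ' u / x' u = ψ v * ψ' v / x' v := by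
  obtain ⟨d₁, hd₁, H₁⟩ := exists_Ioo_of_eventually (hJ.eventually_mem hu)
  obtain ⟨d₂, hd₂, H₂⟩ := exists_Ioo_of_eventually (hJ.eventually_mem hv)
  have hu1 : u - d₁ / 2 ∈ J := H₁ _ ⟨by linarith, by linarith⟩
  have hu2 : u + d₁ / 2 ∈ J := H₁ _ ⟨by linarith, by linarith⟩
  have hv1 : v - d₂ / 2 ∈ J := H₂ _ ⟨by linarith, by linarith⟩
  have hv2 : v + d₂ / 2 ∈ J := H₂ _ ⟨by linarith, by linarith⟩
  -- One interval containing both points in its interior, so that a single slope `k` serves both.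
  set α := min (u - d₁ / 2) (v - d₂ / 2) with hαdef
  set β := max (u + d₁ / 2) (v + d₂ / 2) with hβdef
  have hα : α ∈ J := by rcases min_choice (u - d₁ / 2) (v - d₂ / 2) with h | h <;> rwa [hαdef, h]
  have hβ : β ∈ J := by rcases max_choice (u + d₁ / 2) (v + d₂ / 2) with h | h <;> rwa [hβdef, h]
  have huI : u ∈ Set.Ioo α β := ⟨(min_le_left _ _).trans_lt (by linarith),
    lt_of_lt_of_le (by linarith) (le_max_left _ _)⟩
  have hvI : v ∈ Set.Ioo α β := ⟨(min_le_right _ _).trans_lt (by linarith),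
    lt_of_lt_of_le (by linarith) (le_max_right _ _)⟩
  obtain ⟨k, hk⟩ := sq_affine_of_chord hJ hJ' hx hy hr hx' hψ
    (fun u hu => (hψd u hu).continuousAt.continuousWithinAt) hchord hα hβ (huI.1.trans huI.2)
  have hsub : Set.Icc α β ⊆ J := hJ'.out hα hβ
  have key : ∀ w ∈ Set.Ioo α β, ψ w * ψ' w / x' w = k / 2 := by
    intro w hw
    have hwJ := hsub (Set.Ioo_subset_Icc_self hw)
    have h1 := (hψd w hwJ).pow 2
    have h2 : HasDerivAt (ψ ^ 2) (k * x' w) w := by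
      refine ((((hx w hwJ).sub_const (x α)).const_mul k).const_add (ψ α ^ 2)).congr_of_eventuallyEq
        ?_
      filter_upwards [Icc_mem_nhds hw.1 hw.2] with z hz using hk z hz
    have h3 := h1.unique h2
    have h4 := (hx' w hwJ).ne'
    push_cast at h3
    rw [div_eq_div_iff h4 two_ne_zero]
    linarith
  rw [key u huI, key v hvI]

/-! ### The affine normal and its constancy -/

/-- The determinant of the first two derivatives of a plane curve. -/
def velocityDet (X : ℝ → Plane) (u : ℝ) : ℝ := ⟪deriv (deriv X) u, rot (deriv X u)⟫

/-- The density of the affine arc length of a plane curve. -/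
def affineSpeed (X : ℝ → Plane) (u : ℝ) : ℝ := (velocityDet X u ^ 2) ^ (1 / 6 : ℝ)

/-- The velocity of a plane curve with respect to affine arc length. -/
def affineTangent (X : ℝ → Plane) (u : ℝ) : Plane := (affineSpeed X u)⁻¹ • deriv X u

/-- The affine normal of a plane curve. -/
def affineNormal (X : ℝ → Plane) (u : ℝ) : Plane :=
  (affineSpeed X u)⁻¹ • deriv (affineTangent X) u

namespace IsStrictlyLocallyConvex

variable {I : Set ℝ} {X N : ℝ → Plane} {s : ℝ}

theorem rot_deriv_eq (hX : IsStrictlyLocallyConvex I X N) (hs : s ∈ I) :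
    rot (deriv X s) = ⟪rot (deriv X s), N s⟫ • N s := by
  have hN := hX.norm_normal s hs
  have := eq_smul_of_inner_eq_zero (v := rot (deriv X s)) (hX.regular s hs)
    (hX.normal_ne_zero hs) (by rw [real_inner_comm]; exact hX.inner_normal s hs)
    (by simp [inner_eq_coord]; ring)
  simpa [hN] using this

theorem velocityDet_eq (hX : IsStrictlyLocallyConvex I X N) (hs : s ∈ I) :
    velocityDet X s = ⟪rot (deriv X s), N s⟫ * ⟪deriv (deriv X) s, N s⟫ := by
  rw [velocityDet, hX.rot_deriv_eq hs, real_inner_smul_right, real_inner_smul_left,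
    real_inner_self_eq_norm_sq, hX.norm_normal s hs]
  ring

theorem velocityDet_ne_zero (hX : IsStrictlyLocallyConvex I X N) (hs : s ∈ I) :
    velocityDet X s ≠ 0 := by
  rw [hX.velocityDet_eq hs]
  refine mul_ne_zero (fun h => hX.regular s hs ?_) (hX.inner_deriv_deriv_normal_pos hs).ne'
  have h1 := hX.rot_deriv_eq hs
  rw [h, zero_smul] at h1
  apply plane_ext
  · simpa using congrArg (fun v : Plane => v 1) h1
  · simpa using congrArg (fun v : Plane => v 0) h1

theorem hasDerivAt_coord {Y : ℝ → Plane} {Y' : Plane} {u : ℝ} (h : HasDerivAt Y Y' u)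
    (i : Fin 2) : HasDerivAt (fun u => Y u i) (Y' i) u :=
  (EuclideanSpace.proj (𝕜 := ℝ) i).hasFDerivAt.comp_hasDerivAt u h

theorem differentiableAt_velocityDet (hX : IsStrictlyLocallyConvex I X N) (hs : s ∈ I) :
    DifferentiableAt ℝ (velocityDet X) s := by
  have h1 := hX.hasDerivAt_deriv hs
  have h2 := (hX.differentiableAt_deriv_deriv hs).hasDerivAt
  have : velocityDet X = fun u => deriv (deriv X) u 0 * -deriv X u 1 +
      deriv (deriv X) u 1 * deriv X u 0 := by
    funext u
    rw [velocityDet, inner_eq_coord, rot_zero, rot_one]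
  rw [this]
  exact (((hasDerivAt_coord h2 0).mul (hasDerivAt_coord h1 1).neg).add
    ((hasDerivAt_coord h2 1).mul (hasDerivAt_coord h1 0))).differentiableAt

theorem affineSpeed_pos (hX : IsStrictlyLocallyConvex I X N) (hs : s ∈ I) :
    0 < affineSpeed X s :=
  Real.rpow_pos_of_pos (sq_pos_of_ne_zero (hX.velocityDet_ne_zero hs)) _

/-- The sixth root of the square is the cube root of the absolute value, in a form insensitive to
orientation and differentiable where the determinant does not vanish. -/
theorem affineSpeed_pow_three (u : ℝ) : affineSpeed X u ^ 3 = |velocityDet X u| := by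
  rw [affineSpeed, ← Real.rpow_natCast, ← Real.rpow_mul (sq_nonneg _), ← Real.sqrt_sq_eq_abs,
    Real.sqrt_eq_rpow]
  norm_num

theorem differentiableAt_affineSpeed (hX : IsStrictlyLocallyConvex I X N) (hs : s ∈ I) :
    DifferentiableAt ℝ (affineSpeed X) s :=
  ((hX.differentiableAt_velocityDet hs).pow 2).rpow_const
    (Or.inl (pow_ne_zero 2 (hX.velocityDet_ne_zero hs)))

theorem hasDerivAt_affineTangent (hX : IsStrictlyLocallyConvex I X N) (hs : s ∈ I) :
    HasDerivAt (affineTangent X) (affineSpeed X s • affineNormal X s) s := by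
  rw [affineNormal, smul_inv_smul₀ (hX.affineSpeed_pos hs).ne']
  exact (((hX.differentiableAt_affineSpeed hs).inv (hX.affineSpeed_pos hs).ne').smul
    (hX.hasDerivAt_deriv hs).differentiableAt).hasDerivAt

/-- Differentiating `(affineSpeed X)⁻¹ • X'` gives a multiple of `X'`, which the normal kills, and a
positive multiple of `X''`. -/
theorem inner_affineNormal_pos (hX : IsStrictlyLocallyConvex I X N) (hs : s ∈ I) :
    0 < ⟪affineNormal X s, N s⟫ := by
  have hω := hX.affineSpeed_pos hs
  have h1 := (((hX.differentiableAt_affineSpeed hs).inv hω.ne').hasDerivAt).smul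
    (hX.hasDerivAt_deriv hs)
  have h2 := h1.unique (hX.hasDerivAt_affineTangent hs)
  have h3 := congrArg (fun v : Plane => ⟪v, N s⟫) h2
  simp only [inner_add_left, real_inner_smul_left, hX.inner_normal s hs, mul_zero, add_zero] at h3
  have h4 : 0 < (affineSpeed X)⁻¹ s * ⟪deriv (deriv X) s, N s⟫ :=
    mul_pos (inv_pos.2 hω) (hX.inner_deriv_deriv_normal_pos hs)
  rw [h3] at h4
  exact (pos_iff_pos_of_mul_pos h4).1 hω

/-- The chord property: arbitrarily small chords parallel to the tangent at `X s` have the length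
of the corresponding chords of a parabola. -/
theorem exists_chord (hX : IsStrictlyLocallyConvex I X N) (hs : s ∈ I)
    (h : ∀ᶠ h in 𝓝[>] (0 : ℝ), distJ I X N s h = 2 / 3 * h) {δ : ℝ} (hδ : 0 < δ) :
    ∃ h ∈ Set.Ioo 0 δ, ∃ a ∈ Set.Ioo (s - δ) s, ∃ b ∈ Set.Ioo s (s + δ), ∃ l : ℝ,
      ⟪X a - X s, N s⟫ = h ∧ ⟪X b - X s, N s⟫ = h ∧ X b - X a = l • deriv X s ∧
      l ^ 2 = 8 * h / ⟪deriv (deriv X) s, N s⟫ := by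
  have hA := hX.paramA_spec hs
  have hB := hX.paramB_spec hs
  have ha := hA.2.eventually (Ioo_mem_nhdsLT (sub_lt_self s hδ))
  have hb := hB.2.eventually (Ioo_mem_nhdsGT (lt_add_of_pos_right s hδ))
  obtain ⟨h, h1, h2, h3, h4, h5, h6⟩ := ((hX.chord_sq_eq_of_distJ hs h).and (hA.1.and (hB.1.and
    (ha.and (hb.and (Ioo_mem_nhdsGT hδ)))))).exists
  refine ⟨h, h6, _, h4, _, h5, _, h2.2.1, h3.2.1, eq_smul_of_inner_eq_zero
    (hX.normal_ne_zero hs) (hX.regular s hs) (hX.inner_normal s hs) ?_, ?_⟩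
  · have h7 := h2.2.1
    have h8 := h3.2.1
    rw [normalCoord] at h7 h8
    rw [← sub_sub_sub_cancel_right _ _ (X s), inner_sub_left, h7, h8, sub_self]
  · have h7 := hX.chord_eq hs h
    rw [tangentCoord, tangentCoord, ← inner_sub_left, sub_sub_sub_cancel_right] at h7
    rw [← h7, div_pow, h1, ← real_inner_self_eq_norm_sq]
    have := (hX.inner_deriv_self_pos hs).ne'
    have := (hX.inner_deriv_deriv_normal_pos hs).ne'
    field_simp

/-- Each component of the affine normal in a direction `e` that is transversal to the curve is
locally constant. -/
theorem eventually_inner_affineNormal_eq (hX : IsStrictlyLocallyConvex I X N)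
    (h : ∀ s ∈ I, ∀ᶠ h in 𝓝[>] (0 : ℝ), distJ I X N s h = 2 / 3 * h) (hs : s ∈ I) {e : Plane}
    (he : 0 < ⟪deriv X s, e⟫) :
    ∀ᶠ u in 𝓝 s, ⟪affineNormal X u, e⟫ = ⟪affineNormal X s, e⟫ := by
  have he0 : e ≠ 0 := by rintro rfl; simp at he
  have hepos : 0 < e 0 ^ 2 + e 1 ^ 2 := by
    rw [← norm_sq_eq_coord]; exact pow_pos (norm_pos_iff.2 he0) 2
  set E := e 0 ^ 2 + e 1 ^ 2 with hE
  -- `σ` records the orientation; multiplying the second coordinate by it makes the graph convex.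
  obtain ⟨σ, hσ, hσD⟩ : ∃ σ : ℝ, |σ| = 1 ∧ 0 < σ * velocityDet X s := by
    rcases lt_or_gt_of_ne (hX.velocityDet_ne_zero hs) with h | h
    · exact ⟨-1, by simp, by linarith⟩
    · exact ⟨1, by simp, by linarith⟩
  have hev : ∀ᶠ u in 𝓝 s, u ∈ I ∧ 0 < ⟪deriv X u, e⟫ ∧ 0 < σ * velocityDet X u := by
    refine (hX.isOpen.eventually_mem hs).and (Eventually.and ?_ ?_)
    · exact (hX.hasDerivAt_inner_deriv hs e).continuousAt.eventually (lt_mem_nhds he)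
    · exact ((hX.differentiableAt_velocityDet hs).continuousAt.const_mul σ).eventually
        (lt_mem_nhds hσD)
  obtain ⟨d, hd, H⟩ := exists_Ioo_of_eventually hev
  set J := Set.Ioo (s - d) (s + d) with hJ
  have hω3 : ∀ u ∈ J, affineSpeed X u ^ 3 = σ * velocityDet X u := by
    intro u hu
    rw [affineSpeed_pow_three, ← abs_of_pos (H u hu).2.2, abs_mul, hσ, one_mul]
  have hinner : ∀ u ∈ J, ∀ v : Plane, HasDerivAt (fun u => ⟪X u, v⟫) ⟪deriv X u, v⟫ u := by
    intro u hu v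
    simpa using (hX.hasDerivAt (H u hu).1).inner ℝ (hasDerivAt_const u v)
  have hdet : ∀ v w : Plane, ⟪v, e⟫ * ⟪w, rot e⟫ - ⟪v, rot e⟫ * ⟪w, e⟫ = E * ⟪w, rot v⟫ := by
    intro v w
    simp only [inner_eq_coord, rot_zero, rot_one, hE]
    ring
  filter_upwards [Ioo_mem_nhds (sub_lt_self s hd) (lt_add_of_pos_right s hd)] with u hu
  -- The factor `σ / E` makes `det (X', X'')`, up to sign the cube of the affine speed, the
  -- numerator of the derivative of the slope. Hence `d²y/dx² = ψ ^ (-3)` with `ψ` the `e`-component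
  -- of the affine tangent.
  have key := deriv_sq_div_eq_of_chord (J := J) (x := fun u => ⟪X u, e⟫)
    (x' := fun u => ⟪deriv X u, e⟫) (y := fun u => σ / E * ⟪X u, rot e⟫)
    (r := fun u => σ / E * ⟪deriv X u, rot e⟫ / ⟪deriv X u, e⟫)
    (ψ := fun u => ⟪affineTangent X u, e⟫)
    (ψ' := fun u => ⟪affineSpeed X u • affineNormal X u, e⟫) isOpen_Ioo Set.ordConnected_Ioo
    (fun u hu => hinner u hu e) ?_ ?_ (fun u hu => (H u hu).2.1) ?_ ?_ ?_ hu
    (v := s) ⟨by linarith, by linarith⟩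
  · have hsJ : s ∈ J := ⟨by linarith, by linarith⟩
    have hsimp : ∀ u ∈ J, ⟪affineTangent X u, e⟫ * ⟪affineSpeed X u • affineNormal X u, e⟫ /
        ⟪deriv X u, e⟫ = ⟪affineNormal X u, e⟫ := by
      intro u hu
      have h1 := (H u hu).2.1.ne'
      have h2 := (hX.affineSpeed_pos (H u hu).1).ne'
      rw [affineTangent, real_inner_smul_left, real_inner_smul_left]
      field_simp
    rw [← hsimp u hu, ← hsimp s hsJ]
    exact key
  · intro u hu
    have h1 := (H u hu).2.1.ne'
    refine ((hinner u hu (rot e)).const_mul (σ / E)).congr_deriv ?_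
    field_simp
  · intro u hu
    have h1 := (H u hu).2.1.ne'
    have h2 := (hX.affineSpeed_pos (H u hu).1).ne'
    have h3 := hX.hasDerivAt_inner_deriv (H u hu).1
    refine (((h3 (rot e)).const_mul (σ / E)).div (h3 e) h1).congr_deriv ?_
    have h4 := hdet (deriv X u) (deriv (deriv X) u)
    have h5 := hω3 u hu
    rw [velocityDet] at h5
    rw [affineTangent, real_inner_smul_left, mul_pow, inv_pow, h5]
    have h6 : σ * ⟪deriv (deriv X) u, rot (deriv X u)⟫ ≠ 0 := h5 ▸ pow_ne_zero 3 h2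
    have h7 : σ / E * ⟪deriv (deriv X) u, rot e⟫ * ⟪deriv X u, e⟫ -
        σ / E * ⟪deriv X u, rot e⟫ * ⟪deriv (deriv X) u, e⟫ =
        σ * ⟪deriv (deriv X) u, rot (deriv X u)⟫ := by
      have : σ * ⟪deriv (deriv X) u, rot (deriv X u)⟫ =
          σ / E * (E * ⟪deriv (deriv X) u, rot (deriv X u)⟫) := by field_simp
      rw [this, ← h4]
      ring
    rw [h7]
    field_simp
  · intro u hu
    rw [affineTangent, real_inner_smul_left]
    exact mul_pos (inv_pos.2 (hX.affineSpeed_pos (H u hu).1)) (H u hu).2.1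
  · intro u hu
    simpa using (hX.hasDerivAt_affineTangent (H u hu).1).inner ℝ (hasDerivAt_const u e)
  · intro u hu δ hδ
    obtain ⟨huI, hx', hD⟩ := H u hu
    have hkpos := hX.inner_deriv_deriv_normal_pos huI
    have hDe := hX.velocityDet_eq huI
    set c := ⟪rot (deriv X u), N u⟫ with hc
    set k := ⟪deriv (deriv X) u, N u⟫ with hk
    have hσc : 0 < σ * c := by
      rw [hDe, ← mul_assoc] at hD
      exact (pos_iff_pos_of_mul_pos hD).2 hkpos
    obtain ⟨h', ⟨hh0, hh1⟩, a, ha, b, hb, l, ha1, hb1, hab, hl⟩ := hX.exists_chord huI (h u huI)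
      (lt_min hδ (show 0 < δ * ⟪deriv X u, e⟫ / (σ * c) by positivity))
    have hmin := min_le_left δ (δ * ⟪deriv X u, e⟫ / (σ * c))
    -- Height measured in the `y`-direction above the tangent is the height along the normal times
    -- `σ c / x'`. The second bound on `h'` keeps it below `δ`.
    have hH : ∀ w : ℝ, ⟪X w - X u, N u⟫ = h' →
        σ / E * ⟪X w, rot e⟫ - σ / E * ⟪X u, rot e⟫ -
          σ / E * ⟪deriv X u, rot e⟫ / ⟪deriv X u, e⟫ * (⟪X w, e⟫ - ⟪X u, e⟫) =
        σ * c * h' / ⟪deriv X u, e⟫ := by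
      intro w hw
      have h1 := hdet (deriv X u) (X w - X u)
      rw [hX.rot_deriv_eq huI, real_inner_smul_right, ← hc, hw, inner_sub_left, inner_sub_left] at h1
      have : σ * c * h' = σ / E * (E * (c * h')) := by field_simp
      rw [this, ← h1]
      field_simp
    refine ⟨σ * c * h' / ⟪deriv X u, e⟫, ⟨by positivity, ?_⟩, a, ⟨by linarith [ha.1], ha.2⟩, b,
      ⟨hb.1, by linarith [hb.2]⟩, hH a ha1, hH b hb1, ?_⟩
    · have := hh1.trans_le (min_le_right _ _)
      rw [lt_div_iff₀ hσc] at this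
      rw [div_lt_iff₀ hx']
      linarith
    · rw [← hk] at hl
      have hω := hω3 u hu
      have hωne := (hX.affineSpeed_pos huI).ne'
      rw [← inner_sub_left, hab, real_inner_smul_left, mul_pow, hl, affineTangent,
        real_inner_smul_left, mul_pow, inv_pow, hω, hDe]
      have h8 := hx'.ne'
      have h9 := hkpos.ne'
      have hσ0 : σ ≠ 0 := by rintro rfl; simp at hσc
      have hc0 : c ≠ 0 := by rintro h0; simp [h0] at hσc
      field_simp

/-- The directions `X'` and `X' + rot X'` are both admissible and span the plane, so the affine
normal is locally constant; connectedness of `I` does the rest. -/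
theorem affineNormal_eq (hX : IsStrictlyLocallyConvex I X N)
    (h : ∀ s ∈ I, ∀ᶠ h in 𝓝[>] (0 : ℝ), distJ I X N s h = 2 / 3 * h) {u : ℝ}
    (hs : s ∈ I) (hu : u ∈ I) : affineNormal X u = affineNormal X s := by
  have hloc : ∀ s ∈ I, HasDerivAt (affineNormal X) 0 s := by
    intro s hs
    have hpos := hX.inner_deriv_self_pos hs
    have hrot : ⟪deriv X s, rot (deriv X s)⟫ = 0 := by simp [inner_eq_coord]; ring
    refine (hasDerivAt_const s (affineNormal X s)).congr_of_eventuallyEq ?_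
    filter_upwards [hX.eventually_inner_affineNormal_eq h hs hpos,
      hX.eventually_inner_affineNormal_eq h hs (e := deriv X s + rot (deriv X s))
        (by rw [inner_add_right, hrot, add_zero]; exact hpos)] with u h1 h2
    rw [inner_add_right, inner_add_right, h1, add_right_inj] at h2
    rw [← sub_eq_zero]
    have hne : rot (deriv X s) ≠ 0 := by
      intro h0
      have := hX.velocityDet_ne_zero hs
      rw [velocityDet, h0, inner_zero_right] at this
      exact this rfl
    apply eq_zero_of_inner_eq_zero hne (hX.regular s hs) hrot
    · rw [inner_sub_left, h2, sub_self]
    · rw [inner_sub_left, h1, sub_self]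
  exact hX.isOpen.is_const_of_deriv_eq_zero hX.ordConnected.isPreconnected
    (fun z hz => (hloc z hz).differentiableAt.differentiableWithinAt)
    (fun z hz => (hloc z hz).deriv) hu hs

end IsStrictlyLocallyConvex

/-! ### Parabolas and curves on them -/

theorem dist_eq_abs_iff {x F : Plane} {z : ℝ} : dist x F = |z| ↔ ‖x - F‖ ^ 2 = z ^ 2 := by
  rw [dist_eq_norm, ← sq_abs z]
  exact (sq_eq_sq₀ (norm_nonneg _) (abs_nonneg _)).symm

/-- The parabola with focus `F` and directrix `⟨n, x⟩ = c` is the graph of a quadratic function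
over the direction of the directrix. -/
theorem parabola_equation {F n x : Plane} {c : ℝ} (hn : ‖n‖ = 1) (hc : ⟪n, F⟫ ≠ c)
    (hx : dist x F = |⟪n, x⟫ - c|) :
    x = (F - ((⟪n, F⟫ - c) / 2) • n) + ⟪x - F, rot n⟫ • rot n +
      (⟪x - F, rot n⟫ ^ 2 / 2) • ((⟪n, F⟫ - c)⁻¹ • n) := by
  rw [dist_eq_abs_iff, norm_sq_eq_coord] at hx
  have hn2 : n 0 ^ 2 + n 1 ^ 2 = 1 := by rw [← norm_sq_eq_coord, hn]; norm_num
  have hd : ⟪n, F⟫ - c ≠ 0 := sub_ne_zero.2 hc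
  set d := ⟪n, F⟫ - c with hdd
  have hz : ⟪n, x⟫ - c = ⟪n, x - F⟫ + d := by rw [inner_sub_right, hdd]; ring
  rw [hz] at hx
  simp only [inner_eq_coord, PiLp.sub_apply, rot_zero, rot_one] at hx ⊢
  set p := x 0 - F 0 with hp
  set q := x 1 - F 1 with hq
  set t := p * -n 1 + q * n 0 with ht
  set z := n 0 * p + n 1 * q with hzz
  have hpq : p ^ 2 + q ^ 2 = t ^ 2 + z ^ 2 := by
    rw [ht, hzz]; linear_combination -(p ^ 2 + q ^ 2) * hn2
  -- With `t` along and `z` across the directrix, measured from the focus, the focal equation is `t²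
  -- + z² = (z + d)²`.
  have htz : t ^ 2 = 2 * d * z + d ^ 2 := by linear_combination hx - hpq
  have hcoef : t ^ 2 / 2 * d⁻¹ = z + d / 2 := by
    rw [htz]; field_simp
  apply plane_ext
  · simp only [PiLp.add_apply, PiLp.sub_apply, PiLp.smul_apply, smul_eq_mul, rot_zero]
    rw [← mul_assoc, hcoef, ht, hzz]
    linear_combination hp - p * hn2
  · simp only [PiLp.add_apply, PiLp.sub_apply, PiLp.smul_apply, smul_eq_mul, rot_one]
    rw [← mul_assoc, hcoef, ht, hzz]
    linear_combination hq - q * hn2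

/-- A curve of the form `Y + τ v + (τ² / 2) ξ` with orthogonal nonzero `v` and `ξ` lies on a
parabola. -/
theorem exists_parabola_of_equation {Y v ξ : Plane} (hv : v ≠ 0) (hξ : ξ ≠ 0)
    (ho : ⟪v, ξ⟫ = 0) :
    ∃ C, IsParabola C ∧ ∀ t : ℝ, Y + t • v + (t ^ 2 / 2) • ξ ∈ C := by
  have hξ' : 0 < ‖ξ‖ := norm_pos_iff.2 hξ
  have hv' : 0 < ‖v‖ := norm_pos_iff.2 hv
  set n := ‖ξ‖⁻¹ • ξ with hn
  -- `Y` is the vertex. At distance `t ‖v‖` from the axis the height is `t² ‖ξ‖ / 2 = (t ‖v‖)² / (2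
  -- d)`, so `d` is the distance from focus to directrix.
  set d := ‖v‖ ^ 2 / ‖ξ‖ with hd
  set F := Y + (d / 2) • n with hF
  have hnn : ‖n‖ = 1 := by
    rw [hn, norm_smul, norm_inv, norm_norm, inv_mul_cancel₀ hξ'.ne']
  have hvn : ⟪v, n⟫ = 0 := by rw [hn, real_inner_smul_right, ho, mul_zero]
  have hξn : ξ = ‖ξ‖ • n := by rw [hn, smul_inv_smul₀ hξ'.ne']
  refine ⟨_, ⟨F, n, ⟪n, F⟫ - d, hnn, ?_, rfl⟩, fun t => ?_⟩
  · have : 0 < d := by positivity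
    intro h
    linarith
  · change dist _ F = |_ - (⟪n, F⟫ - d)|
    rw [dist_eq_abs_iff]
    have h1 : Y + t • v + (t ^ 2 / 2) • ξ - F = t • v + (t ^ 2 / 2 * ‖ξ‖ - d / 2) • n := by
      rw [hF]
      nth_rewrite 1 [hξn]
      module
    have h2 : ⟪n, Y + t • v + (t ^ 2 / 2) • ξ⟫ - (⟪n, F⟫ - d) =
        ⟪n, Y + t • v + (t ^ 2 / 2) • ξ - F⟫ + d := by
      rw [inner_sub_right]; ring
    rw [h2, h1, inner_add_right, real_inner_smul_right, real_inner_smul_right,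
      real_inner_comm v n, hvn, real_inner_self_eq_norm_sq, hnn, norm_add_sq_real,
      real_inner_smul_left, real_inner_smul_right, hvn, norm_smul, norm_smul, hnn]
    have hdv : d * ‖ξ‖ = ‖v‖ ^ 2 := div_mul_cancel₀ _ hξ'.ne'
    simp only [mul_pow, Real.norm_eq_abs, sq_abs, mul_one]
    rw [← hdv]
    ring

namespace IsStrictlyLocallyConvex

variable {I : Set ℝ} {X N : ℝ → Plane} {s : ℝ}

/-- A strictly locally convex curve on a parabola, parametrized by the coordinate along the
directrix. -/
theorem exists_equation_of_subset_parabola (hX : IsStrictlyLocallyConvex I X N) {C : Set Plane}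
    (hC : IsParabola C) (hsub : ∀ u ∈ I, X u ∈ C) :
    ∃ (Y v ξ : Plane) (T : Plane → ℝ) (τ' : ℝ → ℝ), Continuous T ∧
      (∀ x ∈ C, x = Y + T x • v + (T x ^ 2 / 2) • ξ) ∧
      ∀ u ∈ I, HasStrictDerivAt (fun u => T (X u)) (τ' u) u ∧ τ' u ≠ 0 ∧
        deriv X u = τ' u • (v + T (X u) • ξ) := by
  obtain ⟨F, n, c, hn, hc, rfl⟩ := hC
  have hτ : ∀ u ∈ I, HasStrictDerivAt (fun u => ⟪X u - F, rot n⟫) ⟪deriv X u, rot n⟫ u := by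
    intro u hu
    refine hasStrictDerivAt_of_hasDerivAt_of_continuousAt ?_
      (hX.hasDerivAt_inner_deriv hu (rot n)).continuousAt
    filter_upwards [hX.isOpen.mem_nhds hu] with z hz
    simpa using ((hX.hasDerivAt hz).sub_const F).inner ℝ (hasDerivAt_const z (rot n))
  refine ⟨F - ((⟪n, F⟫ - c) / 2) • n, rot n, (⟪n, F⟫ - c)⁻¹ • n, fun x => ⟪x - F, rot n⟫,
    fun u => ⟪deriv X u, rot n⟫, by fun_prop, fun x hx => parabola_equation hn hc hx,
    fun u hu => ?_⟩
  have hder : deriv X u = ⟪deriv X u, rot n⟫ •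
      (rot n + ⟪X u - F, rot n⟫ • ((⟪n, F⟫ - c)⁻¹ • n)) := by
    have h1 := (hτ u hu).hasDerivAt
    have h2 := ((h1.smul_const (rot n)).const_add (F - ((⟪n, F⟫ - c) / 2) • n)).add
      (((h1.pow 2).div_const 2).smul_const ((⟪n, F⟫ - c)⁻¹ • n))
    have h3 := h2.congr_of_eventuallyEq (f₁ := X) (by
      filter_upwards [hX.isOpen.mem_nhds hu] with z hz
      exact parabola_equation hn hc (hsub z hz))
    refine ((hX.hasDerivAt hu).unique h3).trans ?_
    push_cast
    module
  refine ⟨hτ u hu, fun h0 => hX.regular u hu ?_, hder⟩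
  have h0 : ⟪deriv X u, rot n⟫ = 0 := h0
  rw [hder, h0, zero_smul]

/-- A strictly locally convex curve on a parabola is an open part of it. -/
theorem isOpenPartOfParabola_of_subset (hX : IsStrictlyLocallyConvex I X N) {C : Set Plane}
    (hC : IsParabola C) (hsub : ∀ u ∈ I, X u ∈ C) : IsOpenPartOfParabola I X := by
  obtain ⟨Y, v, ξ, T, τ', hT, hCeq, hτ⟩ := hX.exists_equation_of_subset_parabola hC hsub
  -- `T ∘ X` is an open map because its derivative does not vanish. As `T` is injective on `C`, the
  -- trace is cut out of `C` by the preimage of this image.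
  have hopen : IsOpen ((fun u => T (X u)) '' I) := by
    rw [isOpen_iff_mem_nhds]
    rintro _ ⟨u, hu, rfl⟩
    rw [← (hτ u hu).1.map_nhds_eq (hτ u hu).2.1]
    exact image_mem_map (hX.isOpen.mem_nhds hu)
  refine ⟨C, hC, T ⁻¹' ((fun u => T (X u)) '' I), hopen.preimage hT, ?_⟩
  ext x
  constructor
  · rintro ⟨u, hu, rfl⟩
    exact ⟨hsub u hu, u, hu, rfl⟩
  · rintro ⟨hx, u, hu, hxu⟩
    refine ⟨u, hu, ?_⟩
    have hxu : T (X u) = T x := hxu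
    rw [hCeq x hx, hCeq (X u) (hsub u hu), ← hxu, ← hCeq (X u) (hsub u hu)]

/-- On a parabola the height over a tangent is a multiple of the squared increment of `T`. The chord
ends therefore have opposite increments, and the squared chord is proportional to `h`. -/
theorem distJ_of_isOpenPartOfParabola (hX : IsStrictlyLocallyConvex I X N)
    (h : IsOpenPartOfParabola I X) (hs : s ∈ I) :
    ∀ᶠ h in 𝓝[>] (0 : ℝ), distJ I X N s h = 2 / 3 * h := by
  obtain ⟨C, hC, U, -, hU⟩ := h
  have hsub : ∀ u ∈ I, X u ∈ C := fun u hu => (hU ▸ Set.mem_image_of_mem X hu : X u ∈ C ∩ U).1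
  obtain ⟨Y, v, ξ, T, τ', hT, hCeq, hτ⟩ := hX.exists_equation_of_subset_parabola hC hsub
  set w := v + T (X s) • ξ with hw
  have hwN : ⟪w, N s⟫ = 0 := by
    have := hX.inner_normal s hs
    rw [(hτ s hs).2.2, real_inner_smul_left] at this
    exact (mul_eq_zero.1 this).resolve_left (hτ s hs).2.1
  have hdiff : ∀ u ∈ I, X u - X s = (T (X u) - T (X s)) • w +
      ((T (X u) - T (X s)) ^ 2 / 2) • ξ := by
    intro u hu
    rw [hw]
    nth_rewrite 1 [hCeq _ (hsub u hu), hCeq _ (hsub s hs)]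
    module
  have hheight : ∀ u ∈ I, normalCoord X N s u = (T (X u) - T (X s)) ^ 2 / 2 * ⟪ξ, N s⟫ := by
    intro u hu
    rw [normalCoord, hdiff u hu, inner_add_left, real_inner_smul_left, real_inner_smul_left, hwN,
      mul_zero, zero_add]
  apply hX.distJ_of_chord_sq_eq hs (C := 8 * ⟪w, deriv X s⟫ ^ 2 / ⟪ξ, N s⟫)
  filter_upwards [(hX.paramA_spec hs).1, (hX.paramB_spec hs).1, hX.chord_pos hs,
    self_mem_nhdsWithin] with h ⟨ha, ha1, _⟩ ⟨hb, hb1, _⟩ hL hpos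
  have hpos : 0 < h := hpos
  have hLe := hX.chord_eq hs h
  rw [hheight _ ha] at ha1
  rw [hheight _ hb] at hb1
  rw [tangentCoord, tangentCoord, hdiff _ ha, hdiff _ hb, inner_add_left, inner_add_left,
    real_inner_smul_left, real_inner_smul_left, real_inner_smul_left, real_inner_smul_left] at hLe
  set p := T (X (paramA I X N s h)) - T (X s)
  set q := T (X (paramB I X N s h)) - T (X s)
  have hg : ⟪ξ, N s⟫ ≠ 0 := by
    intro h0
    rw [h0, mul_zero] at ha1
    linarith
  have hpq : q ^ 2 = p ^ 2 := by
    have := hb1.trans ha1.symm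
    have := mul_right_cancel₀ hg this
    linarith
  -- Equal increments would make the chord degenerate.
  have hpq' : q = -p := by
    rcases sq_eq_sq_iff_eq_or_eq_neg.1 hpq with h1 | h1
    · rw [h1, sub_self] at hLe
      linarith
    · exact h1
  rw [hLe, hpq', ← ha1]
  field_simp
  ring

/-- With constant affine normal `ξ` the affine tangent is `v + τ ξ`, where `τ` is affine arc length
up to a constant; a second integration makes the curve quadratic in `τ`. -/
theorem isOpenPartOfParabola_of_distJ (hX : IsStrictlyLocallyConvex I X N)
    (h : ∀ s ∈ I, ∀ᶠ h in 𝓝[>] (0 : ℝ), distJ I X N s h = 2 / 3 * h) :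
    IsOpenPartOfParabola I X := by
  obtain ⟨s, hs⟩ := hX.nonempty
  set ξ := affineNormal X s with hξ
  have hξN := hX.inner_affineNormal_pos hs
  rw [← hξ] at hξN
  have hξ0 : ξ ≠ 0 := by intro h0; simp [h0] at hξN
  have hξn : ‖ξ‖ ^ 2 ≠ 0 := pow_ne_zero 2 (norm_ne_zero_iff.2 hξ0)
  have hconst : ∀ {Z : ℝ → Plane}, (∀ u ∈ I, HasDerivAt Z 0 u) → ∀ u ∈ I, Z u = Z s := by
    intro Z hZ u hu
    exact hX.isOpen.is_const_of_deriv_eq_zero hX.ordConnected.isPreconnected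
      (fun z hz => (hZ z hz).differentiableAt.differentiableWithinAt)
      (fun z hz => (hZ z hz).deriv) hu hs
  have hV : ∀ u ∈ I, HasDerivAt (affineTangent X) (affineSpeed X u • ξ) u := by
    intro u hu
    rw [hξ, ← hX.affineNormal_eq h hs hu]
    exact hX.hasDerivAt_affineTangent hu
  -- Taking the `ξ`-component of the affine tangent fixes the additive constant of `τ` so that `v`
  -- is orthogonal to `ξ`.
  set τ : ℝ → ℝ := fun u => ⟪affineTangent X u, ξ⟫ / ‖ξ‖ ^ 2 with hτdef
  have hτ : ∀ u ∈ I, HasDerivAt τ (affineSpeed X u) u := by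
    intro u hu
    refine (((hV u hu).inner ℝ (hasDerivAt_const u ξ)).div_const _).congr_deriv ?_
    rw [inner_zero_right, zero_add, real_inner_smul_left, real_inner_self_eq_norm_sq]
    field_simp
  set v := affineTangent X s - τ s • ξ with hv
  have hVeq : ∀ u ∈ I, affineTangent X u = v + τ u • ξ := by
    intro u hu
    have := hconst (Z := fun u => affineTangent X u - τ u • ξ) (fun u hu => by
      exact ((hV u hu).sub ((hτ u hu).smul_const ξ)).congr_deriv (sub_self _)) u hu
    rw [hv, ← this]
    abel
  have hvξ : ⟪v, ξ⟫ = 0 := by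
    rw [hv, inner_sub_left, real_inner_smul_left, real_inner_self_eq_norm_sq, hτdef]
    field_simp
    ring
  have hv0 : v ≠ 0 := by
    intro h0
    have h1 := hVeq s hs
    rw [h0, zero_add] at h1
    have h2 : ⟪affineTangent X s, N s⟫ = 0 := by
      rw [affineTangent, real_inner_smul_left, hX.inner_normal s hs, mul_zero]
    rw [h1, real_inner_smul_left] at h2
    have h3 := (mul_eq_zero.1 h2).resolve_right hξN.ne'
    rw [h3, zero_smul, affineTangent, smul_eq_zero] at h1
    exact h1.elim (inv_ne_zero (hX.affineSpeed_pos hs).ne') (hX.regular s hs)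
  have hXeq : ∀ u ∈ I, X u = (X s - τ s • v - (τ s ^ 2 / 2) • ξ) + τ u • v + (τ u ^ 2 / 2) • ξ := by
    intro u hu
    have := hconst (Z := fun u => X u - τ u • v - (τ u ^ 2 / 2) • ξ) (fun u hu => by
      refine (((hX.hasDerivAt hu).sub ((hτ u hu).smul_const v)).sub
        ((((hτ u hu).pow 2).div_const 2).smul_const ξ)).congr_deriv ?_
      have h1 : deriv X u = affineSpeed X u • affineTangent X u := by
        rw [affineTangent, smul_inv_smul₀ (hX.affineSpeed_pos hu).ne']
      rw [h1, hVeq u hu]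
      push_cast
      module) u hu
    rw [← this]
    abel
  obtain ⟨C, hC, hmem⟩ := exists_parabola_of_equation (Y := X s - τ s • v - (τ s ^ 2 / 2) • ξ)
    hv0 hξ0 hvξ
  exact hX.isOpenPartOfParabola_of_subset hC fun u hu => by
    rw [hXeq u hu]
    exact hmem (τ u)

end IsStrictlyLocallyConvex
end PlaneCurve

end

theorem theorem5 (I : Set ℝ) (X N : ℝ → PlaneCurve.Plane)
    (hX : PlaneCurve.IsStrictlyLocallyConvex I X N) :
    List.TFAE
      [∃ lam mu : ℝ → ℝ, ∀ s ∈ I, ∀ᶠ h in 𝓝[>] (0 : ℝ),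
          PlaneCurve.distJ I X N s h = lam s * h ^ mu s,
        ∀ s ∈ I, ∀ᶠ h in 𝓝[>] (0 : ℝ), PlaneCurve.distJ I X N s h = 2 / 3 * h,
        PlaneCurve.IsOpenPartOfParabola I X] := by
  tfae_have 1 → 2 := fun ⟨_, _, h⟩ s hs => hX.eventually_distJ_of_eq_mul_rpow hs (h s hs)
  tfae_have 2 → 1 := fun h =>
    ⟨fun _ => 2 / 3, fun _ => 1, fun s hs => by simpa only [Real.rpow_one] using h s hs⟩
  tfae_have 2 → 3 := hX.isOpenPartOfParabola_of_distJ
  tfae_have 3 → 2 := fun h _ hs => hX.distJ_of_isOpenPartOfParabola h hs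
  tfae_finish
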